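/- **Theorem 3.2.** Let $b>0$, $\alpha>-1$, and let $m\in\mathbb C$ with $\operatorname{Re} m>-1$ and $\operatorname{Re} m+\alpha>-1$. Let $J_m$ be the Bessel function of the first kind of order $m$. For $f\in C^3[0,b]$ (real-valued), $\omega\ge 1$ and $N\ge 1$, let $P_Nf$ be the polynomial of degree at most $N$ that interpolates $f$ in the points $x_k=\frac b2+\frac b2\cos\frac{k\pi}{N}$, $k=0,\dots,N$, and put $$I_2[f]=\int_0^b x^\alpha\ln(x)f(x)J_m(\omega x)\,dx,\qquad I_2^{CCF}[f]=\int_0^b x^\alpha\ln(x)P_Nf(x)J_m(\omega x)\,dx .$$ Write $\|\cdot\|_\infty$ for the maximum norm on $[0,b]$. Then there are constants $c_1,c_2,c_3,c_4>0$, independent of $\omega$, $f$ and $N$ (they may depend on $b,\alpha,m$), such that with $$C_1(\omega)=\begin{cases}c_1\,\omega^{-\alpha-1},&-1<\alpha<0,\\ c_2\,\omega^{-1},&\alpha\ge0,\end{cases}\qquad C_2(\omega)=\begin{cases}c_3(1+\ln\omega)\,\omega^{-\alpha-1},&-1<\alpha<0,\\ c_4\,\omega^{-1},&\alpha\ge0,\end{cases}$$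 and $C_2^*(\omega)=C_2(\omega)$ for $\alpha\neq0$, $C_2^*(\omega)=c_3(1+\ln\omega)\,\omega^{-1}$ for $\alpha=0$, the following holds for all $f\in C^3[0,b]$, $N\ge1$ and $\omega\ge1$. Both integrals converge absolutely. Put $$B_1=\begin{cases}\dfrac{b^{\alpha+1}\bigl(1-(\alpha+1)\ln b\bigr)}{(\alpha+1)^2}\,\|f-P_Nf\|_\infty,&0<b\le1,\\[2mm] \dfrac{2+b^{\alpha+1}\bigl((\alpha+1)\ln b-1\bigr)}{(\alpha+1)^2}\,\|f-P_Nf\|_\infty,&b>1,\end{cases}$$ $$B_2=b\,C_2(\omega)\,\|f''-P_N''f\|_\infty,$$ $$B_3=\frac{3b}{2\omega}\bigl(C_1(\omega)+|\alpha-m|\,C_2^*(\omega)\bigr)\|f''-P_N''f\|_\infty+\frac{C_2(\omega)}{\omega}\Bigl[\frac1b|f'(b)-P_N'f(b)|+\frac73\,b\,\|f'''-P_N'''f\|_\infty\Bigr].$$ If $m$ is real and $m\ge0$, then $$\bigl|I_2[f]-I_2^{CCF}[f]\bigr|\le\min\{B_1,B_2,B_3\},$$ and for every admissible complex $m$, $$\bigl|I_2[f]-I_2^{CCF}[f]\bigr|\le\min\{B_2,B_3\}.$$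 -/

import Mathlib

open Set Polynomial

noncomputable section

namespace CCF

/-- The Bessel function of the first kind of complex order `m` on `x ≥ 0` (principal powers),
`J_m(x) = ∑ₖ (-1)ᵏ / (k! Γ(m + k + 1)) * (x / 2) ^ (m + 2 k)`. -/
def besselJ (m : ℂ) (x : ℝ) : ℂ :=
  ∑' k : ℕ, (-1 : ℂ) ^ k / ((k.factorial : ℂ) * Complex.Gamma (m + k + 1)) *
    ((x / 2 : ℝ) : ℂ) ^ (m + 2 * k)

/-- The Clenshaw-Curtis points `x_k = b/2 + (b/2) cos (k π / N)` of `[0, b]`, `k = 0, …, N`. -/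
def node (b : ℝ) (N k : ℕ) : ℝ :=
  b / 2 + b / 2 * Real.cos (k * Real.pi / N)

/-- The polynomial `P_N f` of degree at most `N` that interpolates `f` in the `N + 1`
Clenshaw-Curtis points of `[0, b]`. -/
def interp (b : ℝ) (N : ℕ) (f : ℝ → ℝ) : ℝ[X] :=
  Lagrange.interpolate (Finset.range (N + 1)) (node b N) (fun k => f (node b N k))

/-- The integrand `x ^ α ln(x) f(x) J_m(ω x)`. -/
def integrand (α : ℝ) (m : ℂ) (ω : ℝ) (f : ℝ → ℝ) (x : ℝ) : ℂ :=
  ((x ^ α * Real.log x * f x : ℝ) : ℂ) * besselJ m (ω * x)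

/-- The transform `I₂[f] = ∫₀ᵇ x ^ α ln(x) f(x) J_m(ω x) dx`. -/
def transform (b α : ℝ) (m : ℂ) (ω : ℝ) (f : ℝ → ℝ) : ℂ :=
  ∫ x in (0 : ℝ)..b, integrand α m ω f x

/-- The Clenshaw-Curtis-Filon rule `I₂^CCF[f] = ∫₀ᵇ x ^ α ln(x) P_N f(x) J_m(ω x) dx`. -/
def rule (b α : ℝ) (m : ℂ) (ω : ℝ) (N : ℕ) (f : ℝ → ℝ) : ℂ :=
  transform b α m ω (fun x => (interp b N f).eval x)

/-- `f⁽ᵏ⁾ - (P_N f)⁽ᵏ⁾` on `[0, b]`, with one-sided derivatives of `f` at the endpoints. -/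
def derivErr (b : ℝ) (N k : ℕ) (f : ℝ → ℝ) (x : ℝ) : ℝ :=
  iteratedDerivWithin k f (Icc 0 b) x - (derivative^[k] (interp b N f)).eval x

/-- The maximum norm on `[0, b]`. -/
def supNorm (b : ℝ) (g : ℝ → ℝ) : ℝ :=
  ⨆ x : Icc (0 : ℝ) b, |g x|

/-- `C₁(ω)`: the rate of the algebraic weight. -/
def C₁ (c₁ c₂ α ω : ℝ) : ℝ :=
  if α < 0 then c₁ / ω ^ (α + 1) else c₂ / ω

/-- `C₂(ω)`: the rate of the logarithmic weight. -/
def C₂ (c₃ c₄ α ω : ℝ) : ℝ :=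
  if α < 0 then c₃ * (1 + Real.log ω) / ω ^ (α + 1) else c₄ / ω

/-- The variant of `C₂(ω)` that keeps the logarithm at `α = 0`; equal to `C₂(ω)` if `α ≠ 0`. -/
def C₂log (c₃ c₄ α ω : ℝ) : ℝ :=
  if α ≤ 0 then c₃ * (1 + Real.log ω) / ω ^ (α + 1) else c₄ / ω

/-- The first bound: an explicit constant times `‖f - P_N f‖`. -/
def bound₁ (b α : ℝ) (N : ℕ) (f : ℝ → ℝ) : ℝ :=
  if b ≤ 1 then
    b ^ (α + 1) * (1 - (α + 1) * Real.log b) / (α + 1) ^ 2 * supNorm b (derivErr b N 0 f)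
  else
    (2 + b ^ (α + 1) * ((α + 1) * Real.log b - 1)) / (α + 1) ^ 2 * supNorm b (derivErr b N 0 f)

/-- The second bound `b C₂(ω) ‖f'' - (P_N f)''‖`. -/
def bound₂ (c₃ c₄ b α ω : ℝ) (N : ℕ) (f : ℝ → ℝ) : ℝ :=
  b * C₂ c₃ c₄ α ω * supNorm b (derivErr b N 2 f)

/-- The third bound, in inverse powers of `ω`. -/
def bound₃ (c₁ c₂ c₃ c₄ b α : ℝ) (m : ℂ) (ω : ℝ) (N : ℕ) (f : ℝ → ℝ) : ℝ :=
  3 * b / (2 * ω) * (C₁ c₁ c₂ α ω + ‖(α : ℂ) - m‖ * C₂log c₃ c₄ α ω) *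
      supNorm b (derivErr b N 2 f) +
    C₂ c₃ c₄ α ω / ω *
      (1 / b * |derivErr b N 1 f b| + 7 / 3 * b * supNorm b (derivErr b N 3 f))

end CCF

end

namespace CCF

/-! ### The power series of the Bessel function -/

/-! The quadrature error is the transform of `g = f - P_N f`, and `g` vanishes at `0` and `b`
because both endpoints are nodes. So `g / x` stays bounded, `(g / x)'` is controlled by `g''` and
`(g / x)''` by `g'''` (`IsError.abs_quot₁_le`, `IsError.abs_quot₂_le`). Writing `x ^ α ln x · g = x
^ (α + 1) ln x · (g / x)` raises the exponent above `0`, where the kernel against `J_m(ω x)` has a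
primitive of size `O(1 / ω)` for every `α > -1`. One integration by parts against that primitive
(`norm_integral_mul_le`) gives the second bound.

For the third bound, the relation `(x ^ (m + 1) J_{m+1})' = x ^ (m + 1) J_m` is used first. It gains
a factor `1 / ω` and leaves three integrals of `g / x` or `(g / x)'` against kernels with `J_{m+1}`,
and each of these is again integrated by parts (`exists_norm_integral_integrand_le`).

The primitives of the kernels are estimated in `exists_kernel_bound`. An energy argument for `√x
J_m` gives `J_m = O(x ^ (-1/2))`, and with it the integrals of `u ^ α J_m` and `u ^ α ln u J_m` over
`[0, X]` are bounded uniformly in `X` when `α ≤ 0`. The substitution `u = ω t` turns this into the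
rate `ω ^ (-α - 1)`; the factor `1 + ln ω` comes from `ln t = ln u - ln ω`. For `α > 0` the weight
is integrated by parts against the bare Bessel kernel.

The first bound needs `|J_ν| ≤ 1` for real `ν ≥ 0` (`abs_besselR_le_one`). Neumann's formula writes
`J_ν(x)²` as an average of values of `J_{2ν}`, so the supremum `M` of `|J_ν(x)|` over all `ν ≥ 0`
and `x > 0` satisfies `M² ≤ M`. This forces `M ≤ 1` once `M` is known to be finite
(`exists_besselR_sq_le`). -/

lemma norm_inv_Gamma_add_nat_le {m : ℂ} (hm : 0 ≤ m.re) (n : ℕ) :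
    ‖(Complex.Gamma (m + n + 1))⁻¹‖ ≤ ‖(Complex.Gamma (m + 1))⁻¹‖ / n.factorial := by
  induction n with
  | zero => simp
  | succ n ih =>
    have hre : ((n : ℝ) + 1) ≤ ‖m + n + 1‖ := by
      refine le_trans ?_ (Complex.re_le_norm _)
      simp; linarith
    have hn : (0 : ℝ) < (n : ℝ) + 1 := by positivity
    have h := Complex.one_div_Gamma_eq_self_mul_one_div_Gamma_add_one (m + n + 1)
    rw [h, norm_mul] at ih
    have e : m + ((n + 1 : ℕ) : ℂ) + 1 = m + n + 1 + 1 := by push_cast; ring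
    rw [e, Nat.factorial_succ, Nat.cast_mul, div_mul_eq_div_div_swap, Nat.cast_add_one,
      le_div_iff₀ hn]
    calc _ ≤ ‖(Complex.Gamma (m + n + 1 + 1))⁻¹‖ * ‖m + n + 1‖ := by gcongr
      _ ≤ _ := by rw [mul_comm]; exact ih

/-- The term `k = 0` is kept apart; all later ones belong to the order `m + 1`, whose real part is
positive, so that the factorial estimate applies. -/
lemma exists_norm_inv_Gamma_add_nat_le {m : ℂ} (hm : -1 < m.re) :
    ∃ C, 0 ≤ C ∧ ∀ k : ℕ, ‖(Complex.Gamma (m + k + 1))⁻¹‖ ≤ C := by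
  refine ⟨max ‖(Complex.Gamma (m + 1))⁻¹‖ ‖(Complex.Gamma (m + 1 + 1))⁻¹‖,
    le_max_of_le_left (norm_nonneg _), fun k => ?_⟩
  cases k with
  | zero => simp
  | succ k =>
    have h := norm_inv_Gamma_add_nat_le (m := m + 1) (by simp; linarith) k
    have e : m + ((k + 1 : ℕ) : ℂ) + 1 = m + 1 + k + 1 := by push_cast; ring
    rw [e]
    refine le_max_of_le_right (h.trans (div_le_self (norm_nonneg _) ?_))
    exact_mod_cast Nat.one_le_iff_ne_zero.2 k.factorial_ne_zero

/-- The coefficients of the power series of `(x / 2) ^ (-m) * J_m(x)` in `x ^ 2 / 4`. -/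
noncomputable def besselCoeff (m : ℂ) (k : ℕ) : ℂ :=
  (-1) ^ k / (k.factorial * Complex.Gamma (m + k + 1))

/-- The entire function `B_m` with `J_m(x) = (x / 2) ^ m * B_m(x ^ 2 / 4)`. -/
noncomputable def besselB (m z : ℂ) : ℂ := ∑' k, besselCoeff m k * z ^ k

lemma norm_besselCoeff_le {m : ℂ} {C : ℝ} (hC : ∀ k : ℕ, ‖(Complex.Gamma (m + k + 1))⁻¹‖ ≤ C)
    (k : ℕ) : ‖besselCoeff m k‖ ≤ C / k.factorial := by
  have e : besselCoeff m k = (-1) ^ k * ((Complex.Gamma (m + k + 1))⁻¹ / k.factorial) := by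
    rw [besselCoeff]; ring
  rw [e, norm_mul, norm_pow, norm_neg, norm_one, one_pow, one_mul, norm_div, Complex.norm_natCast]
  gcongr
  exact hC k

lemma summable_norm_besselB {m : ℂ} (hm : -1 < m.re) (z : ℂ) :
    Summable fun k => ‖besselCoeff m k * z ^ k‖ := by
  obtain ⟨C, -, hC⟩ := exists_norm_inv_Gamma_add_nat_le hm
  refine Summable.of_nonneg_of_le (fun _ => norm_nonneg _) (fun k => ?_)
    ((Real.summable_pow_div_factorial ‖z‖).mul_left C)
  rw [norm_mul, norm_pow]
  calc _ ≤ C / k.factorial * ‖z‖ ^ k := by gcongr; exact norm_besselCoeff_le hC k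
    _ = _ := by ring

lemma norm_besselB_le {m : ℂ} {C : ℝ} (hC : ∀ k : ℕ, ‖(Complex.Gamma (m + k + 1))⁻¹‖ ≤ C)
    (z : ℂ) : ‖besselB m z‖ ≤ C * Real.exp ‖z‖ := by
  have hs : HasSum (fun k : ℕ => C * (‖z‖ ^ k / k.factorial)) (C * Real.exp ‖z‖) := by
    refine HasSum.mul_left C ?_
    rw [Real.exp_eq_exp_ℝ]
    exact NormedSpace.expSeries_div_hasSum_exp ‖z‖
  refine tsum_of_norm_bounded hs (fun k => ?_)
  rw [norm_mul, norm_pow]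
  calc _ ≤ C / k.factorial * ‖z‖ ^ k := by gcongr; exact norm_besselCoeff_le hC k
    _ = _ := by ring

lemma besselCoeff_succ (m : ℂ) (k : ℕ) :
    besselCoeff m (k + 1) * (k + 1 : ℕ) = -besselCoeff (m + 1) k := by
  have e : m + ((k + 1 : ℕ) : ℂ) + 1 = m + 1 + k + 1 := by push_cast; ring
  have h1 : ((k.factorial : ℂ)) ≠ 0 := by exact_mod_cast k.factorial_ne_zero
  have h2 : ((k + 1 : ℕ) : ℂ) ≠ 0 := by exact_mod_cast k.succ_ne_zero
  simp only [besselCoeff, e, Nat.factorial_succ, Nat.cast_mul, div_eq_mul_inv, mul_inv]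
  rw [pow_succ]
  field_simp

lemma besselCoeff_eq (m : ℂ) (k : ℕ) :
    besselCoeff m k = (m + 1 + k) * besselCoeff (m + 1) k := by
  have h := Complex.one_div_Gamma_eq_self_mul_one_div_Gamma_add_one (m + k + 1)
  have e : m + 1 + k + 1 = m + k + 1 + 1 := by ring
  simp only [besselCoeff, e, div_eq_mul_inv, mul_inv, h]
  ring

lemma hasDerivAt_besselB {m : ℂ} (hm : -1 < m.re) (z : ℂ) :
    HasDerivAt (besselB m) (-besselB (m + 1) z) z := by
  obtain ⟨C, hC0, hC⟩ := exists_norm_inv_Gamma_add_nat_le hm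
  set R : ℝ := ‖z‖ + 1
  have hR : 0 ≤ R := by positivity
  have key := hasDerivAt_tsum_of_isPreconnected
    (g := fun k z => besselCoeff m k * z ^ k)
    (g' := fun k z => besselCoeff m k * (k * z ^ (k - 1)))
    (u := fun k : ℕ => C / k.factorial * (k * R ^ (k - 1)))
    (t := Metric.ball 0 R) (y₀ := 0) (y := z) ?_ Metric.isOpen_ball
    (convex_ball _ _).isPreconnected
    (fun k y _ => (hasDerivAt_pow k y).const_mul _) ?_ (by simp [R]; positivity)
    (summable_norm_besselB hm 0).of_norm (by simp [R])
  · have hs : Summable fun k => besselCoeff m k * (k * z ^ (k - 1)) := by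
      rw [← summable_nat_add_iff 1]
      have := (summable_norm_besselB (m := m + 1) (by simp; linarith) z).of_norm.neg
      refine this.congr fun k => ?_
      rw [← mul_assoc, besselCoeff_succ]; simp
    refine key.congr_deriv ?_
    symm
    -- The term `k = 0`, with its truncated exponent `0 - 1 = 0`, is killed by the factor `k`; the
    -- shift by one then turns order `m` into `m + 1`.
    rw [hs.tsum_eq_zero_add, besselB, ← tsum_neg]
    simp only [CharP.cast_eq_zero, zero_mul, mul_zero, zero_add]
    refine tsum_congr fun k => ?_
    rw [← mul_assoc, besselCoeff_succ]; simp
  · rw [← summable_nat_add_iff 1]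
    refine ((Real.summable_pow_div_factorial R).mul_left C).congr fun k => ?_
    rw [Nat.factorial_succ]
    push_cast
    have h1 : ((k.factorial : ℝ)) ≠ 0 := by exact_mod_cast k.factorial_ne_zero
    field_simp
  · intro k y hy
    rw [norm_mul, norm_mul, norm_pow, Complex.norm_natCast]
    have : ‖y‖ ≤ R := by simpa using (le_of_lt (by simpa using hy : ‖y‖ < R))
    gcongr
    exact norm_besselCoeff_le hC k

/-- The coefficient identity `besselCoeff_eq` splits the series in two; the part carrying the factor
`k` is `z` times the derivative of `besselB (m + 1)`, hence minus `z` times the function of order `m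
+ 2`. -/
lemma besselB_eq {m : ℂ} (hm : -1 < m.re) (z : ℂ) :
    besselB m z = (m + 1) * besselB (m + 1) z - z * besselB (m + 1 + 1) z := by
  have h1 : -1 < (m + 1).re := by simp; linarith
  have h2 : -1 < (m + 1 + 1).re := by simp; linarith
  have s0 := (summable_norm_besselB h1 z).of_norm.mul_left (m + 1)
  have s2 := (summable_norm_besselB h2 z).of_norm.mul_left z
  have s : Summable fun k : ℕ => (k : ℂ) * (besselCoeff (m + 1) k * z ^ k) := by
    rw [← summable_nat_add_iff 1]
    refine s2.neg.congr fun k => ?_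
    have := besselCoeff_succ (m + 1) k
    rw [pow_succ]; linear_combination (-z * z ^ k) * this
  have e : z * besselB (m + 1 + 1) z = -∑' k : ℕ, (k : ℂ) * (besselCoeff (m + 1) k * z ^ k) := by
    rw [s.tsum_eq_zero_add, besselB, ← tsum_mul_left, Nat.cast_zero, zero_mul, zero_add, ← tsum_neg]
    refine tsum_congr fun k => ?_
    have := besselCoeff_succ (m + 1) k
    rw [pow_succ]; linear_combination (z * z ^ k) * this
  rw [e, besselB, besselB, ← tsum_mul_left, sub_neg_eq_add, ← s0.tsum_add s]
  refine tsum_congr fun k => ?_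
  rw [besselCoeff_eq]; ring

/-! ### The Bessel function on the positive half-line -/

lemma besselJ_eq (m : ℂ) {x : ℝ} (hx : 0 < x) :
    besselJ m x = ((x : ℂ) / 2) ^ m * besselB m ((x : ℂ) ^ 2 / 4) := by
  have hx2 : ((x : ℂ) / 2) ≠ 0 := by
    simp [hx.ne']
  rw [besselJ, besselB, ← tsum_mul_left]
  refine tsum_congr fun k => ?_
  have e : ((x / 2 : ℝ) : ℂ) = (x : ℂ) / 2 := by push_cast; ring
  have e2 : ((x : ℂ) / 2) ^ (2 * (k : ℂ)) = ((x : ℂ) ^ 2 / 4) ^ k := by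
    have : (2 * (k : ℂ)) = ((2 * k : ℕ) : ℂ) := by push_cast; ring
    rw [this, Complex.cpow_natCast, pow_mul]; congr 1; ring
  rw [e, Complex.cpow_add _ _ hx2, e2, besselCoeff]; ring

lemma hasDerivAt_besselJ {m : ℂ} (hm : -1 < m.re) {x : ℝ} (hx : 0 < x) :
    HasDerivAt (besselJ m) (m / x * besselJ m x - besselJ (m + 1) x) x := by
  have hxc : (x : ℂ) ≠ 0 := by exact_mod_cast hx.ne'
  have hsl : (x : ℂ) / 2 ∈ Complex.slitPlane := by
    have : (x : ℂ) / 2 = ((x / 2 : ℝ) : ℂ) := by push_cast; ring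
    rw [this, Complex.ofReal_mem_slitPlane]; positivity
  have h1 : HasDerivAt (fun z : ℂ => (z / 2) ^ m) (m * ((x : ℂ) / 2) ^ (m - 1) * (1 / 2)) x :=
    ((hasDerivAt_id (x : ℂ)).div_const 2).cpow_const hsl
  have h2 : HasDerivAt (fun z : ℂ => besselB m (z ^ 2 / 4))
      (-besselB (m + 1) ((x : ℂ) ^ 2 / 4) * (((2 : ℕ) * (x : ℂ) ^ 1) / 4)) x :=
    (hasDerivAt_besselB hm _).comp (x : ℂ) ((hasDerivAt_pow 2 (x : ℂ)).div_const 4)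
  have h := (h1.mul h2).comp_ofReal
  have heq : besselJ m =ᶠ[nhds x]
      fun y : ℝ => ((y : ℂ) / 2) ^ m * besselB m ((y : ℂ) ^ 2 / 4) := by
    filter_upwards [lt_mem_nhds hx] with y hy using besselJ_eq m hy
  refine (h.congr_of_eventuallyEq heq).congr_deriv ?_
  rw [besselJ_eq m hx, besselJ_eq _ hx, Complex.cpow_sub _ _ (div_ne_zero hxc two_ne_zero),
    Complex.cpow_add _ _ (div_ne_zero hxc two_ne_zero), Complex.cpow_one]
  field_simp
  push_cast
  ring

lemma besselJ_recurrence {m : ℂ} (hm : -1 < m.re) {x : ℝ} (hx : 0 < x) :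
    besselJ m x + besselJ (m + 1 + 1) x = 2 * (m + 1) / x * besselJ (m + 1) x := by
  have hxc : (x : ℂ) ≠ 0 := by exact_mod_cast hx.ne'
  have h2 := div_ne_zero hxc two_ne_zero
  rw [besselJ_eq _ hx, besselJ_eq _ hx, besselJ_eq _ hx, besselB_eq hm,
    Complex.cpow_add _ _ h2, Complex.cpow_add _ _ h2, Complex.cpow_one]
  field_simp
  ring

/-- This form, which lowers the order, is equivalent to `(x ^ (m + 1) J_{m+1})' = x ^ (m + 1) J_m`
and drives the oscillatory integrations by parts. -/
lemma hasDerivAt_besselJ_add_one {m : ℂ} (hm : -1 < m.re) {x : ℝ} (hx : 0 < x) :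
    HasDerivAt (besselJ (m + 1)) (besselJ m x - (m + 1) / x * besselJ (m + 1) x) x := by
  refine (hasDerivAt_besselJ (m := m + 1) (by simp; linarith) hx).congr_deriv ?_
  linear_combination - besselJ_recurrence hm hx

lemma continuousOn_besselJ {m : ℂ} (hm : -1 < m.re) : ContinuousOn (besselJ m) (Ioi 0) :=
  fun _ hx => (hasDerivAt_besselJ hm hx).continuousAt.continuousWithinAt

lemma norm_cpow_half (m : ℂ) {x : ℝ} (hx : 0 < x) : ‖((x : ℂ) / 2) ^ m‖ = (x / 2) ^ m.re := by
  have : (x : ℂ) / 2 = ((x / 2 : ℝ) : ℂ) := by push_cast; ring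
  rw [this, Complex.norm_cpow_eq_rpow_re_of_pos (by positivity)]

lemma norm_besselJ_le {m : ℂ} {C : ℝ} (hC : ∀ k : ℕ, ‖(Complex.Gamma (m + k + 1))⁻¹‖ ≤ C)
    {x : ℝ} (hx : 0 < x) : ‖besselJ m x‖ ≤ C * (x / 2) ^ m.re * Real.exp (x ^ 2 / 4) := by
  have e : ‖(x : ℂ) ^ 2 / 4‖ = x ^ 2 / 4 := by simp
  have h := norm_besselB_le hC ((x : ℂ) ^ 2 / 4)
  rw [besselJ_eq m hx, norm_mul, norm_cpow_half m hx]
  rw [e] at h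
  calc _ ≤ (x / 2) ^ m.re * (C * Real.exp (x ^ 2 / 4)) := by gcongr
    _ = _ := by ring

/-- `w = √x J_m(x)` satisfies `w'' = -(1 - (m² - 1/4) / x²) w`, so that its energy
`|w|² + |w'|²` stays bounded. -/
lemma norm_besselJ_sq_mul_le {m : ℂ} (hm : -1 < m.re) {x : ℝ} (hx : 1 ≤ x) :
    ‖besselJ m x‖ ^ 2 * x ≤
      (‖besselJ m 1‖ ^ 2 + ‖(m + 1 / 2) * besselJ m 1 - besselJ (m + 1) 1‖ ^ 2) *
        Real.exp ‖m ^ 2 - 1 / 4‖ := by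
  set κ := ‖m ^ 2 - 1 / 4‖ with hκ
  set w : ℝ → ℂ := fun x => (√x : ℂ) * besselJ m x with hw
  set v : ℝ → ℂ := fun x => (√x : ℂ) * ((m + 1 / 2) / x * besselJ m x - besselJ (m + 1) x) with hv
  have hsq : ∀ x : ℝ, 0 < x → HasDerivAt (fun x : ℝ => (√x : ℂ)) ((√x : ℂ) / (2 * x)) x := by
    intro x hx
    have hs : (√x : ℂ) ≠ 0 := by exact_mod_cast (Real.sqrt_pos.2 hx).ne'
    have hss : (√x : ℂ) ^ 2 = x := by exact_mod_cast Real.sq_sqrt hx.le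
    refine (Real.hasDerivAt_sqrt hx.ne').ofReal_comp.congr_deriv ?_
    push_cast
    rw [← hss]; field_simp
  have hw' : ∀ x : ℝ, 0 < x → HasDerivAt w (v x) x := by
    intro x hx
    have hxc : (x : ℂ) ≠ 0 := by exact_mod_cast hx.ne'
    refine ((hsq x hx).mul (hasDerivAt_besselJ hm hx)).congr_deriv ?_
    simp only [hv]; field_simp; ring
  have hv' : ∀ x : ℝ, 0 < x → HasDerivAt v (-(1 - (m ^ 2 - 1 / 4) / x ^ 2) * w x) x := by
    intro x hx
    have hxc : (x : ℂ) ≠ 0 := by exact_mod_cast hx.ne'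
    have hd : HasDerivAt (fun x : ℝ => (m + 1 / 2) / (x : ℂ)) (-(m + 1 / 2) / (x : ℂ) ^ 2) x := by
      refine ((HasDerivAt.div (hasDerivAt_const (x : ℂ) (m + 1 / 2)) (hasDerivAt_id (x : ℂ))
        hxc).comp_ofReal).congr_deriv ?_
      simp
    refine ((hsq x hx).mul ((hd.mul (hasDerivAt_besselJ hm hx)).sub
      (hasDerivAt_besselJ_add_one hm hx))).congr_deriv ?_
    simp only [hw, Pi.mul_apply, Pi.sub_apply]; field_simp; ring
  -- The derivative of the energy is at most `κ / x²` times the energy, so `exp (κ / x)` is the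
  -- integrating factor that makes the product decrease. It tends to `1` at infinity, hence costs
  -- only the constant `exp κ`.
  have hE : ∀ x : ℝ, 0 < x → HasDerivAt (fun x => (‖w x‖ ^ 2 + ‖v x‖ ^ 2) * Real.exp (κ / x))
      ((2 * inner ℝ (w x) (v x) +
        2 * inner ℝ (v x) (-(1 - (m ^ 2 - 1 / 4) / x ^ 2) * w x)) * Real.exp (κ / x) +
        (‖w x‖ ^ 2 + ‖v x‖ ^ 2) * (Real.exp (κ / x) * (-κ / x ^ 2))) x := by
    intro x hx
    have hd : HasDerivAt (fun x : ℝ => κ / x) (-κ / x ^ 2) x := by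
      refine (HasDerivAt.div (hasDerivAt_const x κ) (hasDerivAt_id x) hx.ne').congr_deriv ?_
      simp
    exact ((hw' x hx).norm_sq.add (hv' x hx).norm_sq).mul hd.exp
  have hanti : AntitoneOn (fun x => (‖w x‖ ^ 2 + ‖v x‖ ^ 2) * Real.exp (κ / x)) (Ici 1) := by
    refine antitoneOn_of_deriv_nonpos (convex_Ici 1)
      (fun x hx => (hE x (lt_of_lt_of_le one_pos hx)).continuousAt.continuousWithinAt) ?_ ?_
    · intro x hx
      rw [interior_Ici] at hx
      exact (hE x (one_pos.trans hx)).differentiableAt.differentiableWithinAt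
    · intro x hx
      rw [interior_Ici] at hx
      have hx0 : 0 < x := one_pos.trans hx
      rw [(hE x hx0).deriv]
      have e : inner ℝ (v x) (-(1 - (m ^ 2 - 1 / 4) / x ^ 2) * w x) =
          - inner ℝ (w x) (v x) + inner ℝ (v x) ((m ^ 2 - 1 / 4) / x ^ 2 * w x) := by
        rw [real_inner_comm (v x) (w x), ← inner_neg_right, ← inner_add_right]; congr 1; ring
      have e2 : inner ℝ (v x) ((m ^ 2 - 1 / 4) / x ^ 2 * w x) ≤
          ‖v x‖ * (κ / x ^ 2 * ‖w x‖) := by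
        refine (real_inner_le_norm _ _).trans (le_of_eq ?_)
        rw [norm_mul (_ / _) (w x), norm_div, ← hκ]; simp
      have e3 : 2 * (‖v x‖ * (κ / x ^ 2 * ‖w x‖)) ≤ (‖w x‖ ^ 2 + ‖v x‖ ^ 2) * (κ / x ^ 2) := by
        have : 0 ≤ κ / x ^ 2 := by positivity
        nlinarith [mul_nonneg this (sq_nonneg (‖v x‖ - ‖w x‖))]
      rw [e]
      have : (2 * inner ℝ (v x) ((m ^ 2 - 1 / 4) / x ^ 2 * w x) -
        (‖w x‖ ^ 2 + ‖v x‖ ^ 2) * (κ / x ^ 2)) * Real.exp (κ / x) ≤ 0 :=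
        mul_nonpos_of_nonpos_of_nonneg (by linarith) (Real.exp_pos _).le
      refine le_trans (le_of_eq ?_) this
      ring
  have h := hanti (mem_Ici.2 le_rfl) (mem_Ici.2 hx) hx
  have hx0 : 0 < x := one_pos.trans_le hx
  have e1 : ‖w x‖ ^ 2 = ‖besselJ m x‖ ^ 2 * x := by
    simp only [hw, norm_mul, Complex.norm_real, Real.norm_eq_abs, mul_pow, sq_abs,
      Real.sq_sqrt hx0.le]
    ring
  have hexp : 1 ≤ Real.exp (κ / x) := Real.one_le_exp (by positivity)
  calc ‖besselJ m x‖ ^ 2 * x ≤ (‖w x‖ ^ 2 + ‖v x‖ ^ 2) * 1 := by rw [← e1]; nlinarith [sq_nonneg ‖v x‖]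
    _ ≤ (‖w x‖ ^ 2 + ‖v x‖ ^ 2) * Real.exp (κ / x) := by gcongr
    _ ≤ _ := h
    _ = _ := by simp [hw, hv]

lemma exists_norm_besselJ_le_rpow {m : ℂ} (hm : -1 < m.re) :
    ∃ C, 0 ≤ C ∧ ∀ x : ℝ, 1 ≤ x → ‖besselJ m x‖ ≤ C * x ^ (-(1 / 2) : ℝ) := by
  obtain ⟨E, hE⟩ : ∃ E, E = (‖besselJ m 1‖ ^ 2 +
    ‖(m + 1 / 2) * besselJ m 1 - besselJ (m + 1) 1‖ ^ 2) * Real.exp ‖m ^ 2 - 1 / 4‖ := ⟨_, rfl⟩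
  refine ⟨√E, Real.sqrt_nonneg _, fun x hx => ?_⟩
  have hx0 : 0 < x := one_pos.trans_le hx
  have h := norm_besselJ_sq_mul_le hm hx
  rw [← hE] at h
  rw [Real.rpow_neg hx0.le, ← Real.sqrt_eq_rpow, ← div_eq_mul_inv, ← Real.sqrt_div' _ hx0.le]
  exact Real.le_sqrt_of_sq_le (by rwa [le_div_iff₀ hx0])

/-! ### A uniform bound for `J_ν`, `ν ≥ 0` real -/

/-- The real-valued Bessel function of real order. -/
noncomputable def besselR (ν x : ℝ) : ℝ := (besselJ ν x).re

lemma ofReal_besselR (ν : ℝ) {x : ℝ} (hx : 0 < x) : (besselR ν x : ℂ) = besselJ ν x := by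
  have h : besselJ ν x = ((∑' k : ℕ, (-1) ^ k / ((k.factorial : ℝ) * Real.Gamma (ν + k + 1)) *
      (x / 2) ^ (ν + 2 * k) : ℝ) : ℂ) := by
    rw [besselJ, Complex.ofReal_tsum]
    refine tsum_congr fun k => ?_
    have e : (ν : ℂ) + k + 1 = ((ν + k + 1 : ℝ) : ℂ) := by push_cast; ring
    have e2 : (ν : ℂ) + 2 * k = ((ν + 2 * k : ℝ) : ℂ) := by push_cast; ring
    rw [e, e2, Complex.Gamma_ofReal, ← Complex.ofReal_cpow (by positivity)]
    push_cast
    ring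
  rw [besselR, h, Complex.ofReal_re]

lemma norm_besselJ_ofReal (ν : ℝ) {x : ℝ} (hx : 0 < x) : ‖besselJ ν x‖ = |besselR ν x| := by
  rw [← ofReal_besselR ν hx, Complex.norm_real, Real.norm_eq_abs]

lemma hasDerivAt_besselR {ν : ℝ} (hν : -1 < ν) {x : ℝ} (hx : 0 < x) :
    HasDerivAt (besselR ν) (ν / x * besselR ν x - besselR (ν + 1) x) x := by
  have h := Complex.reCLM.hasFDerivAt.comp_hasDerivAt x
    (hasDerivAt_besselJ (m := (ν : ℂ)) (by simpa using hν) hx)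
  refine h.congr_deriv ?_
  have e : ((ν : ℂ) + 1) = ((ν + 1 : ℝ) : ℂ) := by push_cast; ring
  rw [e, ← ofReal_besselR _ hx, ← ofReal_besselR _ hx]
  simp only [Complex.reCLM_apply]
  rw [← Complex.ofReal_div, ← Complex.ofReal_mul, ← Complex.ofReal_sub, Complex.ofReal_re]

lemma hasDerivAt_besselR_add_one {ν : ℝ} (hν : -1 < ν) {x : ℝ} (hx : 0 < x) :
    HasDerivAt (besselR (ν + 1)) (besselR ν x - (ν + 1) / x * besselR (ν + 1) x) x := by
  have h := Complex.reCLM.hasFDerivAt.comp_hasDerivAt x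
    (hasDerivAt_besselJ_add_one (m := (ν : ℂ)) (by simpa using hν) hx)
  have e : ((ν : ℂ) + 1) = ((ν + 1 : ℝ) : ℂ) := by push_cast; ring
  rw [e, ← ofReal_besselR _ hx, ← ofReal_besselR _ hx] at h
  refine h.congr_deriv ?_
  simp only [Complex.reCLM_apply]
  rw [← Complex.ofReal_div, ← Complex.ofReal_mul, ← Complex.ofReal_sub, Complex.ofReal_re]

/-- The partial sums of `J_ν² + 2 ∑ J_{ν+k}²`. -/
noncomputable def besselSqSum (ν : ℝ) (N : ℕ) (x : ℝ) : ℝ :=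
  besselR ν x ^ 2 + 2 * ∑ k ∈ Finset.range N, besselR (ν + k + 1) x ^ 2

/-- Averaging the two derivative formulas gives `2 J_μ' = J_{μ-1} - J_{μ+1}`, so the derivatives of
the squares telescope and only the two ends survive. -/
lemma hasDerivAt_besselSqSum {ν : ℝ} (hν : 0 ≤ ν) (N : ℕ) {x : ℝ} (hx : 0 < x) :
    HasDerivAt (besselSqSum ν N)
      (2 * ν / x * besselR ν x ^ 2 - 2 * besselR (ν + N) x * besselR (ν + N + 1) x) x := by
  induction N with
  | zero =>
    have e : besselSqSum ν 0 = fun x => besselR ν x ^ 2 := by ext; simp [besselSqSum]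
    rw [e]
    refine ((hasDerivAt_besselR (by linarith : -1 < ν) hx).pow 2).congr_deriv ?_
    simp only [Nat.cast_zero, add_zero]
    push_cast
    ring
  | succ N ih =>
    have e : besselSqSum ν (N + 1) =
        fun x => besselSqSum ν N x + 2 * besselR (ν + N + 1) x ^ 2 := by
      ext; simp only [besselSqSum, Finset.sum_range_succ]; ring
    have hμ : -1 < ν + N := by have := N.cast_nonneg (α := ℝ); linarith
    have h1 := hasDerivAt_besselR (ν := ν + N + 1) (by linarith) hx
    have h2 := hasDerivAt_besselR_add_one hμ hx
    have h3 := h1.unique h2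
    rw [e]
    refine (ih.add ((h2.pow 2).const_mul 2)).congr_deriv ?_
    push_cast
    rw [← add_assoc ν]
    linear_combination (2 * besselR (ν + N + 1) x) * -h3

/-- `1 / Γ` is entire, hence bounded on the compact range of `δ + 1`; the factorial comes from the
functional equation. The uniformity in `δ` makes the bound on `J_ν` uniform in the order. -/
lemma exists_norm_inv_Gamma_le :
    ∃ G, 0 ≤ G ∧ ∀ δ : ℝ, 0 ≤ δ → δ ≤ 1 → ∀ n k : ℕ,
      ‖(Complex.Gamma (((δ + n : ℝ) : ℂ) + k + 1))⁻¹‖ ≤ G / n.factorial := by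
  obtain ⟨G, hG⟩ := (isCompact_Icc (a := (0 : ℝ)) (b := 1)).exists_bound_of_continuousOn
    (f := fun δ : ℝ => (Complex.Gamma ((δ : ℂ) + 1))⁻¹)
    ((Complex.differentiable_one_div_Gamma.continuous.comp
      (Complex.continuous_ofReal.add continuous_const)).continuousOn)
  refine ⟨G, (norm_nonneg _).trans (hG 0 (by simp)), fun δ h0 h1 n k => ?_⟩
  have h := norm_inv_Gamma_add_nat_le (m := (δ : ℂ)) (by simpa using h0) (n + k)
  have e : ((δ + n : ℝ) : ℂ) + k + 1 = (δ : ℂ) + ((n + k : ℕ) : ℂ) + 1 := by push_cast; ring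
  rw [e]
  have hG0 := hG δ ⟨h0, h1⟩
  refine h.trans ?_
  have : (n.factorial : ℝ) ≤ (n + k).factorial := by
    exact_mod_cast Nat.factorial_le (Nat.le_add_right n k)
  have hp : (0 : ℝ) < n.factorial := by exact_mod_cast n.factorial_pos
  gcongr
  exact (norm_nonneg _).trans hG0

/-- With `ν = δ + n` and `δ ∈ [0, 1]`, the square `J_ν²` is at most the sum `J_δ² + 2 ∑ J_{δ+k}²`.
For `x ≤ 1` the power series suffices. For `x ≥ 1` the derivative of the `N`-th partial sum is `2 δ
J_δ² / x`, integrable since `x J_δ² ≤ E`, minus a product of two Bessel functions of order about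
`N`, which vanishes as `N → ∞`. -/
lemma exists_besselR_sq_le :
    ∃ K, ∀ ν : ℝ, 0 ≤ ν → ∀ x : ℝ, 0 < x → besselR ν x ^ 2 ≤ K := by
  obtain ⟨G, hG0, hG⟩ := exists_norm_inv_Gamma_le
  have hJ : ∀ δ : ℝ, 0 ≤ δ → δ ≤ 1 → ∀ n : ℕ, ∀ x : ℝ, 0 < x → |besselR (δ + n) x| ≤
      G / n.factorial * (x / 2) ^ (δ + n) * Real.exp (x ^ 2 / 4) := by
    intro δ h0 h1 n x hx
    rw [← norm_besselJ_ofReal _ hx]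
    exact norm_besselJ_le (hG δ h0 h1 n) hx
  have hsmall : ∀ δ : ℝ, 0 ≤ δ → δ ≤ 1 → ∀ n : ℕ, ∀ x : ℝ, 0 < x → x ≤ 1 →
      |besselR (δ + n) x| ≤ G * Real.exp 1 * (1 / 2) ^ n := by
    intro δ h0 h1 n x hx hx1
    refine (hJ δ h0 h1 n x hx).trans ?_
    have e1 : (x / 2) ^ (δ + n) ≤ (1 / 2) ^ n := by
      rw [Real.rpow_add (by positivity), Real.rpow_natCast]
      calc _ ≤ (1 : ℝ) * (1 / 2) ^ n := by
            gcongr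
            exact Real.rpow_le_one (by positivity) (by linarith) h0
        _ = _ := one_mul _
    have e2 : Real.exp (x ^ 2 / 4) ≤ Real.exp 1 := Real.exp_le_exp.2 (by nlinarith)
    have e3 : G / n.factorial ≤ G :=
      div_le_self hG0 (by exact_mod_cast Nat.one_le_iff_ne_zero.2 n.factorial_ne_zero)
    calc _ ≤ G * (1 / 2) ^ n * Real.exp 1 := by gcongr
      _ = _ := by ring
  set A := G * Real.exp 1 with hA
  have hA0 : 0 ≤ A := by positivity
  -- The energy bound with `|δ + 1/2| ≤ 3/2` and `|δ² - 1/4| ≤ 1`, so that it no longer depends on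
  -- `δ`.
  set E := (A ^ 2 + (3 / 2 * A + A) ^ 2) * Real.exp 1 with hE
  have hE0 : 0 ≤ E := by positivity
  have hdecay : ∀ δ : ℝ, 0 ≤ δ → δ ≤ 1 → ∀ x : ℝ, 1 ≤ x → besselR δ x ^ 2 * x ≤ E := by
    intro δ h0 h1 x hx
    have h := norm_besselJ_sq_mul_le (m := (δ : ℂ)) (by simp; linarith) hx
    have e : (δ : ℂ) + 1 = ((δ + 1 : ℝ) : ℂ) := by push_cast; ring
    rw [norm_besselJ_ofReal _ (by linarith), sq_abs] at h
    refine h.trans ?_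
    have b0 : ‖besselJ δ 1‖ ≤ A := by
      rw [norm_besselJ_ofReal _ one_pos]
      simpa using hsmall δ h0 h1 0 1 one_pos le_rfl
    have b1 : ‖besselJ (δ + 1) 1‖ ≤ A := by
      rw [e, norm_besselJ_ofReal _ one_pos]
      have := hsmall δ h0 h1 1 1 one_pos le_rfl
      simp only [Nat.cast_one, pow_one] at this
      linarith
    have b2 : ‖((δ : ℂ) + 1 / 2) * besselJ δ 1 - besselJ (δ + 1) 1‖ ≤ 3 / 2 * A + A := by
      refine (norm_sub_le _ _).trans (add_le_add ?_ b1)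
      rw [norm_mul]
      have : ‖(δ : ℂ) + 1 / 2‖ ≤ 3 / 2 := by
        have e' : (δ : ℂ) + 1 / 2 = ((δ + 1 / 2 : ℝ) : ℂ) := by push_cast; ring
        rw [e', Complex.norm_real, Real.norm_eq_abs, abs_of_nonneg (by linarith)]
        linarith
      gcongr
    have b3 : ‖(δ : ℂ) ^ 2 - 1 / 4‖ ≤ 1 := by
      have e' : (δ : ℂ) ^ 2 - 1 / 4 = ((δ ^ 2 - 1 / 4 : ℝ) : ℂ) := by push_cast; ring
      rw [e', Complex.norm_real, Real.norm_eq_abs, abs_le]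
      constructor <;> nlinarith
    rw [hE]
    gcongr
  have hS1 : ∀ δ : ℝ, 0 ≤ δ → δ ≤ 1 → ∀ N, besselSqSum δ N 1 ≤ 3 * A ^ 2 := by
    intro δ h0 h1 N
    have b0 : besselR δ 1 ^ 2 ≤ A ^ 2 := by
      rw [← sq_abs]
      have := hsmall δ h0 h1 0 1 one_pos le_rfl
      simp only [Nat.cast_zero, add_zero, pow_zero, mul_one] at this
      gcongr
    have b1 : ∑ k ∈ Finset.range N, besselR (δ + k + 1) 1 ^ 2 ≤ A ^ 2 := by
      calc _ ≤ ∑ k ∈ Finset.range N, A ^ 2 * (1 / 2) ^ (k + 1) := by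
            refine Finset.sum_le_sum fun k _ => ?_
            have := hsmall δ h0 h1 (k + 1) 1 one_pos le_rfl
            rw [Nat.cast_add_one, ← add_assoc] at this
            rw [← sq_abs]
            have h2 : ((1 : ℝ) / 2) ^ (k + 1) ≤ 1 := pow_le_one₀ (by norm_num) (by norm_num)
            have h3 : (0 : ℝ) ≤ (1 / 2) ^ (k + 1) := by positivity
            calc _ ≤ (A * (1 / 2) ^ (k + 1)) ^ 2 := by gcongr
              _ = A ^ 2 * ((1 / 2) ^ (k + 1) * (1 / 2) ^ (k + 1)) := by ring
              _ ≤ A ^ 2 * ((1 / 2) ^ (k + 1) * 1) := by gcongr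
              _ = _ := by ring
        _ = A ^ 2 * (1 - (1 / 2) ^ N) := by
            rw [← Finset.mul_sum]
            congr 1
            induction N with
            | zero => simp
            | succ N ih => rw [Finset.sum_range_succ, ih]; ring
        _ ≤ A ^ 2 * 1 := by
            have : (0 : ℝ) ≤ (1 / 2) ^ N := by positivity
            gcongr; linarith
        _ = _ := mul_one _
    rw [besselSqSum]; linarith
  refine ⟨3 * A ^ 2 + 2 * E, fun ν hν x hx => ?_⟩
  obtain ⟨δ, n, h0, h1, rfl⟩ : ∃ (δ : ℝ) (n : ℕ), 0 ≤ δ ∧ δ ≤ 1 ∧ ν = δ + n :=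
    ⟨ν - ⌊ν⌋₊, ⌊ν⌋₊, by linarith [Nat.floor_le hν], by linarith [Nat.lt_floor_add_one ν], by ring⟩
  rcases le_total x 1 with hx1 | hx1
  · have := hsmall δ h0 h1 n x hx hx1
    have h2 : ((1 : ℝ) / 2) ^ n ≤ 1 := pow_le_one₀ (by norm_num) (by norm_num)
    have h3 : |besselR (δ + n) x| ≤ A := this.trans (by nlinarith)
    rw [← sq_abs]
    have : |besselR (δ + n) x| ^ 2 ≤ A ^ 2 := by gcongr
    nlinarith
  have hlarge : ∀ N : ℕ, ∀ y : ℝ, 1 ≤ y → y ≤ x →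
      |besselR (δ + N) y| ≤ G * x * Real.exp (x ^ 2 / 4) * (x ^ N / N.factorial) := by
    intro N y hy hyx
    refine (hJ δ h0 h1 N y (by linarith)).trans ?_
    have e1 : (y / 2) ^ (δ + N) ≤ x * x ^ N := by
      calc (y / 2) ^ (δ + N) ≤ x ^ (δ + N) := by gcongr; linarith
        _ ≤ x ^ ((1 + N : ℕ) : ℝ) := by
            refine Real.rpow_le_rpow_of_exponent_le hx1 ?_
            push_cast; linarith
        _ = _ := by rw [Real.rpow_natCast]; ring
    calc _ ≤ G / N.factorial * (x * x ^ N) * Real.exp (x ^ 2 / 4) := by gcongr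
      _ = _ := by ring
  set a : ℕ → ℝ := fun N => G * x * Real.exp (x ^ 2 / 4) * (x ^ N / N.factorial) with ha
  have ha0 : ∀ N, 0 ≤ a N := fun N => by positivity
  have hbound : ∀ N, besselSqSum δ N x ≤ 3 * A ^ 2 + 2 * E + 2 * (a N * a (N + 1)) * x := by
    intro N
    set τ := 2 * (a N * a (N + 1)) with hτ
    have hτ0 : 0 ≤ τ := mul_nonneg two_pos.le (mul_nonneg (ha0 _) (ha0 _))
    have hd : ∀ y : ℝ, 0 < y → HasDerivAt (fun y => besselSqSum δ N y + 2 * E / y - τ * y)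
        (2 * δ / y * besselR δ y ^ 2 - 2 * besselR (δ + N) y * besselR (δ + N + 1) y
          + -(2 * E) / y ^ 2 - τ) y := by
      intro y hy
      have h2 : HasDerivAt (fun y : ℝ => 2 * E / y) (-(2 * E) / y ^ 2) y := by
        refine (HasDerivAt.div (hasDerivAt_const y (2 * E)) (hasDerivAt_id y) hy.ne').congr_deriv ?_
        simp
      have h3 : HasDerivAt (fun y : ℝ => τ * y) τ y := by
        simpa using (hasDerivAt_id y).const_mul τ
      exact ((hasDerivAt_besselSqSum h0 N hy).add h2).sub h3
    -- The term `2 E / y` absorbs the growth caused by `δ`, and `τ y` the truncation error at `N`.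
    have hanti : AntitoneOn (fun y => besselSqSum δ N y + 2 * E / y - τ * y) (Icc 1 x) := by
      refine antitoneOn_of_deriv_nonpos (convex_Icc 1 x) (fun y hy =>
        (hd y (lt_of_lt_of_le one_pos hy.1)).continuousAt.continuousWithinAt) ?_ ?_
      · intro y hy
        rw [interior_Icc] at hy
        exact (hd y (one_pos.trans hy.1)).differentiableAt.differentiableWithinAt
      · intro y hy
        rw [interior_Icc] at hy
        have hy0 : 0 < y := one_pos.trans hy.1
        rw [(hd y hy0).deriv]
        have b1 : 2 * δ / y * besselR δ y ^ 2 ≤ 2 * E / y ^ 2 := by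
          have e : 2 * δ / y * besselR δ y ^ 2 = δ * (2 * (besselR δ y ^ 2 * y)) / y ^ 2 := by
            field_simp
          rw [e]
          have := hdecay δ h0 h1 y hy.1.le
          have hn : 0 ≤ besselR δ y ^ 2 * y := by positivity
          refine div_le_div_of_nonneg_right ?_ (by positivity)
          nlinarith
        have b2 : -(2 * besselR (δ + N) y * besselR (δ + N + 1) y) ≤ τ := by
          have c1 := hlarge N y hy.1.le hy.2.le
          have c2 := hlarge (N + 1) y hy.1.le hy.2.le
          rw [Nat.cast_add_one, ← add_assoc] at c2
          have c3 : |besselR (δ + N) y| * |besselR (δ + N + 1) y| ≤ a N * a (N + 1) := by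
            gcongr
          rw [← abs_mul] at c3
          have := neg_abs_le (besselR (δ + N) y * besselR (δ + N + 1) y)
          rw [hτ]; linarith
        have b3 : -(2 * E) / y ^ 2 = -(2 * E / y ^ 2) := neg_div _ _
        linarith
    have h := hanti (left_mem_Icc.2 hx1) (right_mem_Icc.2 hx1) hx1
    simp only [div_one, mul_one] at h
    have := hS1 δ h0 h1 N
    have : 0 ≤ 2 * E / x := by positivity
    linarith
  have hlim : Filter.Tendsto (fun N => 3 * A ^ 2 + 2 * E + 2 * (a N * a (N + 1)) * x)
      Filter.atTop (nhds (3 * A ^ 2 + 2 * E + 2 * (0 * 0) * x)) := by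
    have ha' : Filter.Tendsto a Filter.atTop (nhds 0) := by
      have := (FloorSemiring.tendsto_pow_div_factorial_atTop x).const_mul
        (G * x * Real.exp (x ^ 2 / 4))
      simpa using this
    exact ((ha'.mul (ha'.comp (Filter.tendsto_add_atTop_nat 1))).const_mul 2).mul_const x
      |>.const_add _
  have hfin := ge_of_tendsto hlim (b := besselR (δ + n) x ^ 2) ?_
  · simpa using hfin
  filter_upwards [Filter.eventually_ge_atTop n] with N hN
  refine le_trans ?_ (hbound N)
  rw [besselSqSum]
  cases n with
  | zero =>
    have := Finset.sum_nonneg (s := Finset.range N) (f := fun k : ℕ => besselR (δ + k + 1) x ^ 2)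
      (fun k _ => sq_nonneg _)
    simp only [Nat.cast_zero, add_zero]
    linarith
  | succ k =>
    have := Finset.single_le_sum (s := Finset.range N)
      (f := fun k : ℕ => besselR (δ + k + 1) x ^ 2) (fun k _ => sq_nonneg _)
      (Finset.mem_range.2 hN)
    rw [Nat.cast_add_one, ← add_assoc]
    nlinarith [sq_nonneg (besselR δ x), sq_nonneg (besselR (δ + k + 1) x)]

/-! ### The product formula and `|J_ν| ≤ 1` -/

lemma Gamma_eq_choose_mul {r : ℂ} (j : ℕ) (h : ∀ i : ℕ, i < j → r ≠ i) :
    Complex.Gamma (r + 1) = j.factorial * Ring.choose r j * Complex.Gamma (r - j + 1) := by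
  rw [← nsmul_eq_mul, ← Ring.descPochhammer_eq_factorial_smul_choose]
  induction j with
  | zero => simp
  | succ j ih =>
    have e : r - ((j + 1 : ℕ) : ℂ) + 1 = r - j := by push_cast; ring
    have hne : r - j ≠ 0 := sub_ne_zero.2 (h j j.lt_succ_self)
    rw [ih fun i hi => h i (hi.trans j.lt_succ_self), descPochhammer_succ_right, smeval_mul, e,
      Complex.Gamma_add_one _ hne, smeval_sub, smeval_X, smeval_natCast]
    simp
    ring

/-- With `s = ν + k`, each product of coefficients is a common factor times `choose s i * choose s
j` with `i + j = k`. The Chu-Vandermonde identity sums these to `choose (2 s) k`. -/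
lemma sum_besselCoeff_mul {ν : ℝ} (hν : 0 ≤ ν) (k : ℕ) :
    ∑ p ∈ Finset.HasAntidiagonal.antidiagonal k, besselCoeff ν p.1 * besselCoeff ν p.2 =
      besselCoeff (2 * ν) k * Complex.Gamma (2 * ν + 2 * k + 1) /
        Complex.Gamma (ν + k + 1) ^ 2 := by
  have hG : ∀ s : ℝ, 0 ≤ s → Complex.Gamma (s + 1) ≠ 0 := by
    intro s hs
    refine Complex.Gamma_ne_zero_of_re_pos ?_
    simp; linarith
  have hne : ∀ s : ℝ, ∀ j : ℕ, (j : ℝ) ≤ s → ∀ i : ℕ, i < j → (s : ℂ) ≠ i := by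
    intro s j hj i hi h
    have : s = i := by exact_mod_cast h
    have : (i : ℝ) < j := by exact_mod_cast hi
    linarith
  have hf : ∀ n : ℕ, (n.factorial : ℂ) ≠ 0 := fun n => by exact_mod_cast n.factorial_ne_zero
  have hs0 : Complex.Gamma (ν + k + 1) ≠ 0 := by
    have := hG (ν + k) (by positivity)
    push_cast at this; exact this
  have hterm : ∀ p ∈ Finset.HasAntidiagonal.antidiagonal k, besselCoeff ν p.1 * besselCoeff ν p.2 =
      (-1) ^ k / Complex.Gamma (ν + k + 1) ^ 2 *
        (Ring.choose ((ν : ℂ) + k) p.1 * Ring.choose ((ν : ℂ) + k) p.2) := by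
    rintro ⟨i, j⟩ hp
    rw [Finset.HasAntidiagonal.mem_antidiagonal] at hp
    simp only at hp ⊢
    subst hp
    have h1 := Gamma_eq_choose_mul (r := ((ν + (i + j : ℕ) : ℝ) : ℂ)) i
      (hne _ _ (by push_cast; linarith [j.cast_nonneg (α := ℝ)]))
    have h2 := Gamma_eq_choose_mul (r := ((ν + (i + j : ℕ) : ℝ) : ℂ)) j
      (hne _ _ (by push_cast; linarith [i.cast_nonneg (α := ℝ)]))
    have g1 := hG (ν + i) (by positivity)
    have g2 := hG (ν + j) (by positivity)
    push_cast at h1 h2 g1 g2 hs0 ⊢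
    have e1 : (ν : ℂ) + (i + j) - i + 1 = ν + j + 1 := by ring
    have e2 : (ν : ℂ) + (i + j) - j + 1 = ν + i + 1 := by ring
    rw [e1] at h1
    rw [e2] at h2
    have hi := hf i
    have hj := hf j
    simp only [besselCoeff]
    have e3 : (Complex.Gamma (ν + (i + j) + 1)) ^ 2 =
      (i.factorial * Ring.choose ((ν : ℂ) + (i + j)) i * Complex.Gamma (ν + j + 1)) *
      (j.factorial * Ring.choose ((ν : ℂ) + (i + j)) j * Complex.Gamma (ν + i + 1)) := by
      rw [← h1, ← h2, sq]
    have c1 : Ring.choose ((ν : ℂ) + (i + j)) i ≠ 0 := by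
      intro h; rw [h] at h1; simp at h1; exact hs0 h1
    have c2 : Ring.choose ((ν : ℂ) + (i + j)) j ≠ 0 := by
      intro h; rw [h] at h2; simp at h2; exact hs0 h2
    rw [e3, pow_add]
    field_simp
  rw [Finset.sum_congr rfl hterm, ← Finset.mul_sum, ← Ring.add_choose_eq k (Commute.all _ _)]
  have h := Gamma_eq_choose_mul (r := ((2 * ν + 2 * k : ℝ) : ℂ)) k
    (hne _ _ (by linarith [k.cast_nonneg (α := ℝ)]))
  push_cast at h
  have e1 : 2 * (ν : ℂ) + 2 * k - k + 1 = 2 * ν + k + 1 := by ring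
  have e2 : (ν : ℂ) + k + (ν + k) = 2 * ν + 2 * k := by ring
  have g := hG (2 * ν + k) (by positivity)
  push_cast at g
  have hk := hf k
  rw [e1] at h
  rw [e2, h, besselCoeff]
  generalize Complex.Gamma (2 * (ν : ℂ) + k + 1) = w at g ⊢
  generalize Ring.choose (2 * (ν : ℂ) + 2 * k) k = c
  field_simp

lemma besselB_sq {ν : ℝ} (hν : 0 ≤ ν) (z : ℂ) :
    besselB ν z ^ 2 = ∑' k, besselCoeff (2 * ν) k * Complex.Gamma (2 * ν + 2 * k + 1) /
        Complex.Gamma (ν + k + 1) ^ 2 * z ^ k := by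
  have hs := summable_norm_besselB (m := (ν : ℂ)) (by simp; linarith) z
  rw [sq, besselB, tsum_mul_tsum_eq_tsum_sum_antidiagonal_of_summable_norm hs hs]
  refine tsum_congr fun k => ?_
  rw [← sum_besselCoeff_mul hν, Finset.sum_mul]
  refine Finset.sum_congr rfl fun p hp => ?_
  rw [Finset.HasAntidiagonal.mem_antidiagonal] at hp
  rw [← hp, pow_add]; ring

/-- Legendre's duplication formula, applied to the Gamma quotient that expresses the Beta integral.
It matches the `k`-th coefficient of `B_ν²` with the `k`-th moment in Neumann's formula. -/
lemma betaIntegral_half {ν : ℝ} (hν : 0 ≤ ν) (k : ℕ) :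
    Complex.betaIntegral (ν + k + 1 / 2) (1 / 2) * 4 ^ k * (2 : ℂ) ^ (2 * (ν : ℂ)) =
      Real.pi * (Complex.Gamma (2 * ν + 2 * k + 1) / Complex.Gamma (ν + k + 1) ^ 2) := by
  have h1 := Complex.Gamma_mul_Gamma_eq_betaIntegral (s := ν + k + 1 / 2) (t := 1 / 2)
    (by simp; positivity) (by simp)
  have h2 := Complex.Gamma_mul_Gamma_add_half (ν + k + 1 / 2)
  have e : (ν : ℂ) + k + 1 / 2 + 1 / 2 = ν + k + 1 := by ring
  have e2 : 2 * ((ν : ℂ) + k + 1 / 2) = 2 * ν + 2 * k + 1 := by ring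
  rw [e, Complex.Gamma_one_half_eq] at h1
  rw [e, e2] at h2
  have g : Complex.Gamma (ν + k + 1) ≠ 0 := by
    refine Complex.Gamma_ne_zero_of_re_pos ?_
    simp; positivity
  have e3 : (Real.pi : ℂ) ^ (1 / 2 : ℂ) = (√Real.pi : ℂ) := by
    rw [Real.sqrt_eq_rpow, Complex.ofReal_cpow Real.pi_pos.le]; push_cast; rfl
  have e4 : (√Real.pi : ℂ) * √Real.pi = Real.pi := by
    exact_mod_cast Real.mul_self_sqrt Real.pi_pos.le
  have e5 : (2 : ℂ) ^ (1 - (2 * (ν : ℂ) + 2 * k + 1)) * (4 ^ k * 2 ^ (2 * (ν : ℂ))) = 1 := by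
    have : (4 : ℂ) ^ k = 2 ^ (2 * (k : ℂ)) := by
      have : (2 * (k : ℂ)) = ((2 * k : ℕ) : ℂ) := by push_cast; ring
      rw [this, Complex.cpow_natCast, pow_mul]; norm_num
    rw [this, ← Complex.cpow_add _ _ two_ne_zero, ← Complex.cpow_add _ _ two_ne_zero]
    ring_nf
    simp
  rw [e3] at h1
  rw [mul_div_assoc', eq_div_iff (pow_ne_zero 2 g)]
  calc _ = (Complex.Gamma (ν + k + 1) * Complex.betaIntegral (ν + k + 1 / 2) (1 / 2)) *
        (4 ^ k * (2 : ℂ) ^ (2 * (ν : ℂ))) * Complex.Gamma (ν + k + 1) := by ring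
    _ = (Complex.Gamma (ν + k + 1 / 2) * Complex.Gamma (ν + k + 1)) * √Real.pi *
        (4 ^ k * (2 : ℂ) ^ (2 * (ν : ℂ))) := by rw [← h1]; ring
    _ = Complex.Gamma (2 * ν + 2 * k + 1) * (√Real.pi * √Real.pi) *
        ((2 : ℂ) ^ (1 - (2 * (ν : ℂ) + 2 * k + 1)) * (4 ^ k * (2 : ℂ) ^ (2 * (ν : ℂ)))) := by
        rw [h2]; ring
    _ = _ := by rw [e4, e5]; ring

/-- The arcsine weight on `(0, 1)`. -/
noncomputable def arcsineWeight (t : ℝ) : ℝ := t ^ (-(1 / 2) : ℝ) * (1 - t) ^ (-(1 / 2) : ℝ)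

lemma ofReal_arcsineWeight {t : ℝ} (ht : t ∈ Ioo (0 : ℝ) 1) :
    (arcsineWeight t : ℂ) = (t : ℂ) ^ ((1 / 2 : ℂ) - 1) * (1 - (t : ℂ)) ^ ((1 / 2 : ℂ) - 1) := by
  have e : (1 / 2 : ℂ) - 1 = ((-(1 / 2) : ℝ) : ℂ) := by push_cast; ring
  have e2 : (1 - (t : ℂ)) = ((1 - t : ℝ) : ℂ) := by push_cast; ring
  rw [arcsineWeight, Complex.ofReal_mul, Complex.ofReal_cpow ht.1.le,
    Complex.ofReal_cpow (by linarith [ht.2]), e, e2]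

open MeasureTheory in
lemma integrableOn_arcsineWeight : IntegrableOn arcsineWeight (Ioo 0 1) := by
  have h := Complex.betaIntegral_convergent (u := 1 / 2) (v := 1 / 2) (by simp) (by simp)
  rw [intervalIntegrable_iff_integrableOn_Ioo_of_le zero_le_one] at h
  have h2 : IntegrableOn (fun t => (arcsineWeight t : ℂ)) (Ioo 0 1) :=
    h.congr_fun (fun t ht => (ofReal_arcsineWeight ht).symm) measurableSet_Ioo
  exact (by simpa using h2.re : Integrable (fun t => arcsineWeight t) (volume.restrict (Ioo 0 1)))

open MeasureTheory in
lemma integral_arcsineWeight : ∫ t in Ioo 0 1, arcsineWeight t = Real.pi := by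
  have h := betaIntegral_half (le_refl 0) 0
  simp only [Complex.ofReal_zero, Nat.cast_zero, mul_zero, zero_add, add_zero, Complex.cpow_zero,
    pow_zero, mul_one, Complex.Gamma_one, one_pow, div_one] at h
  rw [Complex.betaIntegral, intervalIntegral.integral_of_le zero_le_one,
    integral_Ioc_eq_integral_Ioo] at h
  have h2 : ∫ t in Ioo (0 : ℝ) 1, (arcsineWeight t : ℂ) = Real.pi := by
    rw [← h]
    exact setIntegral_congr_fun measurableSet_Ioo fun t ht => ofReal_arcsineWeight ht
  rw [integral_complex_ofReal] at h2
  exact_mod_cast h2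

lemma arcsineWeight_nonneg {t : ℝ} (ht : t ∈ Ioo (0 : ℝ) 1) : 0 ≤ arcsineWeight t :=
  mul_nonneg (Real.rpow_nonneg ht.1.le _) (Real.rpow_nonneg (by linarith [ht.2]) _)

open MeasureTheory in
-- Neumann's formula `J_ν(x)² = (2 / π) ∫ J_{2ν}(2 x cos θ) dθ` over `[0, π / 2]`, with `t = cos²
-- θ`. The series of `J_{2ν}` is integrated term by term; each term is a Beta integral, and the sum
-- is the Cauchy square of the series of `J_ν`.
lemma besselJ_sq_eq_integral {ν : ℝ} (hν : 0 ≤ ν) {x : ℝ} (hx : 0 < x) :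
    Real.pi * besselJ ν x ^ 2 =
      ∫ t in Ioo (0 : ℝ) 1, (arcsineWeight t : ℂ) * besselJ (2 * ν) (2 * x * √t) := by
  have hxc : (x : ℂ) ≠ 0 := by exact_mod_cast hx.ne'
  have hre : -1 < (2 * (ν : ℂ)).re := by simp; linarith
  set F : ℕ → ℝ → ℂ := fun k t =>
    besselCoeff (2 * ν) k * (x : ℂ) ^ (2 * (ν : ℂ)) * ((x : ℂ) ^ 2) ^ k *
      ((t : ℂ) ^ ((ν : ℂ) + k + 1 / 2 - 1) * (1 - (t : ℂ)) ^ ((1 / 2 : ℂ) - 1)) with hF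
  have hFt : ∀ k, ∀ t ∈ Ioo (0 : ℝ) 1, F k t = besselCoeff (2 * ν) k * (x : ℂ) ^ (2 * (ν : ℂ)) *
      ((x : ℂ) ^ 2) ^ k * ((t : ℂ) ^ (ν : ℂ) * (t : ℂ) ^ k) * arcsineWeight t := by
    intro k t ht
    have htc : (t : ℂ) ≠ 0 := by exact_mod_cast ht.1.ne'
    have e : (ν : ℂ) + k + 1 / 2 - 1 = ν + k + (1 / 2 - 1) := by ring
    rw [ofReal_arcsineWeight ht, hF]
    simp only [e]
    rw [Complex.cpow_add _ _ htc, Complex.cpow_add _ _ htc, Complex.cpow_natCast]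
    ring
  have hint : ∀ k, IntegrableOn (F k) (Ioo 0 1) := by
    intro k
    refine Integrable.const_mul ?_ _
    have h := Complex.betaIntegral_convergent (u := (ν : ℂ) + k + 1 / 2) (v := 1 / 2)
      (by simp; positivity) (by simp)
    rwa [intervalIntegrable_iff_integrableOn_Ioo_of_le zero_le_one] at h
  have hFint : ∀ k, ∫ t in Ioo (0 : ℝ) 1, F k t = Real.pi * ((x / 2 : ℂ) ^ (2 * (ν : ℂ)) *
      (besselCoeff (2 * ν) k * Complex.Gamma (2 * ν + 2 * k + 1) /
        Complex.Gamma (ν + k + 1) ^ 2 * ((x : ℂ) ^ 2 / 4) ^ k)) := by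
    intro k
    have h := betaIntegral_half hν k
    have e : ∫ t in Ioo (0 : ℝ) 1, F k t = besselCoeff (2 * ν) k * (x : ℂ) ^ (2 * (ν : ℂ)) *
        ((x : ℂ) ^ 2) ^ k * Complex.betaIntegral (ν + k + 1 / 2) (1 / 2) := by
      rw [Complex.betaIntegral, intervalIntegral.integral_of_le zero_le_one,
        integral_Ioc_eq_integral_Ioo, ← integral_const_mul]
    have e2 : (x : ℂ) ^ (2 * (ν : ℂ)) = (x / 2 : ℂ) ^ (2 * (ν : ℂ)) * 2 ^ (2 * (ν : ℂ)) := by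
      have h2 : (x : ℂ) = ((x / 2 : ℝ) : ℂ) * ((2 : ℝ) : ℂ) := by push_cast; ring
      conv_lhs => rw [h2]
      rw [Complex.mul_cpow_ofReal_nonneg (by positivity) (by positivity)]
      push_cast; rfl
    rw [e, e2, div_pow]
    calc _ = (x / 2 : ℂ) ^ (2 * (ν : ℂ)) * besselCoeff (2 * ν) k * ((x : ℂ) ^ 2) ^ k / 4 ^ k *
          (Complex.betaIntegral (ν + k + 1 / 2) (1 / 2) * 4 ^ k * (2 : ℂ) ^ (2 * (ν : ℂ))) := by
          field_simp
      _ = _ := by rw [h]; ring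
  -- Since `t ^ (ν + k) ≤ 1`, the terms are dominated by the absolutely convergent series of
  -- `besselB (2 * ν)` at `x²`.
  have hsum : Summable fun k => ∫ t in Ioo (0 : ℝ) 1, ‖F k t‖ := by
    have hs := ((summable_norm_besselB hre ((x : ℂ) ^ 2)).mul_left
      ‖(x : ℂ) ^ (2 * (ν : ℂ))‖).mul_right Real.pi
    refine Summable.of_nonneg_of_le (fun k => integral_nonneg fun _ => norm_nonneg _)
      (fun k => ?_) hs
    rw [← integral_arcsineWeight, ← integral_const_mul]
    refine setIntegral_mono_on (hint k).norm (integrableOn_arcsineWeight.const_mul _)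
      measurableSet_Ioo fun t ht => ?_
    rw [hFt k t ht, norm_mul _ (arcsineWeight t : ℂ), Complex.norm_real, Real.norm_eq_abs,
      abs_of_nonneg (arcsineWeight_nonneg ht), norm_mul _ (_ * _)]
    refine mul_le_mul_of_nonneg_right ?_ (arcsineWeight_nonneg ht)
    have : ‖(t : ℂ) ^ (ν : ℂ) * (t : ℂ) ^ k‖ ≤ 1 := by
      rw [norm_mul, norm_pow, Complex.norm_cpow_eq_rpow_re_of_pos ht.1, Complex.norm_real,
        Real.norm_eq_abs, abs_of_pos ht.1, Complex.ofReal_re]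
      exact mul_le_one₀ (Real.rpow_le_one ht.1.le ht.2.le hν) (by have := ht.1; positivity)
        (pow_le_one₀ ht.1.le ht.2.le)
    calc _ ≤ ‖besselCoeff (2 * ν) k * (x : ℂ) ^ (2 * (ν : ℂ)) * ((x : ℂ) ^ 2) ^ k‖ * 1 := by
          gcongr
      _ = _ := by rw [norm_mul, norm_mul, norm_mul]; ring
  have h := hasSum_integral_of_summable_integral_norm hint hsum
  have hL := h.tsum_eq
  rw [tsum_congr hFint, tsum_mul_left, tsum_mul_left, ← besselB_sq hν] at hL
  have e : (x / 2 : ℂ) ^ (2 * (ν : ℂ)) = ((x / 2 : ℂ) ^ (ν : ℂ)) ^ 2 := by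
    rw [sq, ← Complex.cpow_add _ _ (div_ne_zero hxc two_ne_zero)]; ring_nf
  rw [besselJ_eq _ hx, mul_pow, ← e, hL]
  refine setIntegral_congr_fun measurableSet_Ioo fun t ht => ?_
  have hst : (√t : ℂ) ^ 2 = t := by exact_mod_cast Real.sq_sqrt ht.1.le
  have hpos : 0 < 2 * x * √t := by have := Real.sqrt_pos.2 ht.1; positivity
  rw [tsum_congr fun k => hFt k t ht, tsum_mul_right, mul_comm, besselJ_eq _ hpos]
  congr 1
  have e1 : (((2 * x * √t : ℝ) : ℂ)) / 2 = ((x : ℝ) : ℂ) * ((√t : ℝ) : ℂ) := by push_cast; ring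
  have e2 : (((2 * x * √t : ℝ) : ℂ)) ^ 2 / 4 = (x : ℂ) ^ 2 * t := by
    rw [← hst]; push_cast; ring
  have e3 : (√t : ℂ) ^ (2 * (ν : ℂ)) = (t : ℂ) ^ (ν : ℂ) := by
    have : 2 * (ν : ℂ) = ((2 * ν : ℝ) : ℂ) := by push_cast; ring
    rw [this, ← Complex.ofReal_cpow (Real.sqrt_nonneg t), ← Complex.ofReal_cpow ht.1.le,
      Real.rpow_mul (Real.sqrt_nonneg t)]
    norm_num [Real.sq_sqrt ht.1.le]
  rw [e1, e2, Complex.mul_cpow_ofReal_nonneg hx.le (Real.sqrt_nonneg t), e3, besselB,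
    ← tsum_mul_left]
  refine tsum_congr fun k => ?_
  rw [mul_pow]; ring

open MeasureTheory in
lemma abs_besselR_le_one {ν : ℝ} (hν : 0 ≤ ν) {x : ℝ} (hx : 0 < x) : |besselR ν x| ≤ 1 := by
  obtain ⟨K, hK⟩ := exists_besselR_sq_le
  set S : Set ℝ := {a | ∃ ν x : ℝ, 0 ≤ ν ∧ 0 < x ∧ a = |besselR ν x|} with hS
  have hbdd : BddAbove S := by
    refine ⟨√K, ?_⟩
    rintro a ⟨ν, x, hν, hx, rfl⟩
    exact Real.abs_le_sqrt (hK ν hν x hx)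
  set M := sSup S with hM
  have hle : ∀ ν x : ℝ, 0 ≤ ν → 0 < x → |besselR ν x| ≤ M := fun ν x hν hx =>
    le_csSup hbdd ⟨ν, x, hν, hx, rfl⟩
  -- The order `2 ν` and the argument `2 x √t` stay in the family over which `M` is the supremum,
  -- and the arcsine weight has total mass `π`.
  have hsq : ∀ ν x : ℝ, 0 ≤ ν → 0 < x → |besselR ν x| ^ 2 ≤ M := by
    intro ν x hν hx
    have h := congrArg norm (besselJ_sq_eq_integral hν hx)
    rw [norm_mul, norm_pow, norm_besselJ_ofReal _ hx, Complex.norm_real, Real.norm_eq_abs,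
      abs_of_pos Real.pi_pos] at h
    have h2 : ‖∫ t in Ioo (0 : ℝ) 1, (arcsineWeight t : ℂ) * besselJ (2 * ν) (2 * x * √t)‖ ≤
        ∫ t in Ioo (0 : ℝ) 1, arcsineWeight t * M := by
      refine norm_integral_le_of_norm_le (integrableOn_arcsineWeight.mul_const M) ?_
      refine (ae_restrict_iff' measurableSet_Ioo).2 (Filter.Eventually.of_forall fun t ht => ?_)
      have hpos : 0 < 2 * x * √t := by have := Real.sqrt_pos.2 ht.1; positivity
      have e : 2 * (ν : ℂ) = ((2 * ν : ℝ) : ℂ) := by push_cast; ring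
      rw [norm_mul, e, norm_besselJ_ofReal _ hpos, Complex.norm_real, Real.norm_eq_abs,
        abs_of_nonneg (arcsineWeight_nonneg ht)]
      exact mul_le_mul_of_nonneg_left (hle _ _ (by positivity) hpos) (arcsineWeight_nonneg ht)
    rw [integral_mul_const, integral_arcsineWeight, ← h] at h2
    exact le_of_mul_le_mul_left h2 Real.pi_pos
  have hM0 : 0 ≤ M := (abs_nonneg _).trans (hle 0 1 le_rfl one_pos)
  have hM1 : M ≤ √M := by
    refine csSup_le ⟨_, 0, 1, le_rfl, one_pos, rfl⟩ ?_
    rintro a ⟨ν, x, hν, hx, rfl⟩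
    exact Real.le_sqrt_of_sq_le (hsq ν x hν hx)
  have : M ≤ 1 := by
    by_contra! h
    have : M * M ≤ M := by
      calc M * M ≤ √M * √M := by gcongr
        _ = M := Real.mul_self_sqrt hM0
    nlinarith
  exact (hle ν x hν hx).trans this

/-! ### Integrability at the left endpoint and integration by parts -/

lemma exists_abs_log_le_rpow {ε : ℝ} (hε : 0 < ε) (R : ℝ) :
    ∃ D, 0 ≤ D ∧ ∀ t ∈ Ioc 0 R, |Real.log t| ≤ D * t ^ (-ε) := by
  refine ⟨(1 + |R| ^ (2 * ε)) / ε, by positivity, fun t ht => ?_⟩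
  have htp : 0 < t ^ (-ε) := Real.rpow_pos_of_pos ht.1 _
  have hR : 0 ≤ |R| ^ (2 * ε) := by positivity
  rcases le_total t 1 with h1 | h1
  · have h := (Real.abs_log_mul_self_rpow_lt t ε ht.1 h1 hε).le
    rw [abs_mul, abs_of_pos (Real.rpow_pos_of_pos ht.1 ε)] at h
    have e : |Real.log t| = |Real.log t| * t ^ ε * t ^ (-ε) := by
      rw [mul_assoc, ← Real.rpow_add ht.1]; simp
    rw [e]
    refine mul_le_mul_of_nonneg_right (h.trans ?_) htp.le
    gcongr; linarith
  · rw [abs_of_nonneg (Real.log_nonneg h1)]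
    refine (Real.log_le_rpow_div ht.1.le hε).trans ?_
    have e : t ^ ε = t ^ (2 * ε) * t ^ (-ε) := by
      rw [← Real.rpow_add ht.1]; congr 1; ring
    have h2 : t ^ (2 * ε) ≤ |R| ^ (2 * ε) :=
      Real.rpow_le_rpow ht.1.le (ht.2.trans (le_abs_self R)) (by positivity)
    rw [e, div_mul_eq_mul_div]
    gcongr
    linarith

lemma intervalIntegrable_of_norm_le {E : Type*} [NormedAddCommGroup E] {φ : ℝ → E} {R β B : ℝ}
    (hR : 0 ≤ R) (hβ : -1 < β) (hc : ContinuousOn φ (Ioc 0 R))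
    (hB : ∀ t ∈ Ioc 0 R, ‖φ t‖ ≤ B * (t ^ β * (1 + |Real.log t|))) :
    IntervalIntegrable φ MeasureTheory.volume 0 R := by
  -- The logarithm is given half of the margin above `-1`, which leaves the exponent `(β - 1) / 2 >
  -- -1`.
  obtain ⟨D, hD0, hD⟩ := exists_abs_log_le_rpow (ε := (β + 1) / 2) (by linarith) R
  have h1 : IntervalIntegrable (fun t : ℝ => |B| * (t ^ β + D * t ^ (β + -((β + 1) / 2))))
      MeasureTheory.volume 0 R :=
    ((intervalIntegral.intervalIntegrable_rpow' hβ).add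
      ((intervalIntegral.intervalIntegrable_rpow' (by linarith)).const_mul D)).const_mul |B|
  refine h1.mono_fun' ?_ ?_
  · rw [uIoc_of_le hR]
    exact hc.aestronglyMeasurable measurableSet_Ioc
  · rw [uIoc_of_le hR]
    refine (MeasureTheory.ae_restrict_iff' measurableSet_Ioc).2
      (Filter.Eventually.of_forall fun t ht => (hB t ht).trans ?_)
    have htp : 0 < t ^ β := Real.rpow_pos_of_pos ht.1 _
    have h2 := hD t ht
    simp only
    rw [Real.rpow_add ht.1]
    calc _ ≤ |B| * (t ^ β * (1 + |Real.log t|)) := by gcongr; exact le_abs_self B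
      _ ≤ |B| * (t ^ β * (1 + D * t ^ (-((β + 1) / 2)))) := by gcongr
      _ = _ := by ring

lemma exists_norm_besselJ_le_rpow_re {m : ℂ} (hm : -1 < m.re) (R : ℝ) :
    ∃ D, 0 ≤ D ∧ ∀ t ∈ Ioc 0 R, ‖besselJ m t‖ ≤ D * t ^ m.re := by
  obtain ⟨C, hC0, hC⟩ := exists_norm_inv_Gamma_add_nat_le hm
  refine ⟨C * (1 / 2) ^ m.re * Real.exp (R ^ 2 / 4), by positivity, fun t ht => ?_⟩
  refine (norm_besselJ_le hC ht.1).trans ?_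
  have e : (t / 2) ^ m.re = (1 / 2) ^ m.re * t ^ m.re := by
    rw [← Real.mul_rpow (by norm_num) ht.1.le]; congr 1; ring
  have h2 : Real.exp (t ^ 2 / 4) ≤ Real.exp (R ^ 2 / 4) := by
    have := ht.1
    have := ht.2
    apply Real.exp_le_exp.2
    gcongr
  have : 0 ≤ t ^ m.re := Real.rpow_nonneg ht.1.le _
  rw [e]
  calc _ ≤ C * ((1 / 2) ^ m.re * t ^ m.re) * Real.exp (R ^ 2 / 4) := by gcongr
    _ = _ := by ring

lemma exists_norm_besselJ_mul_le_rpow_re {m : ℂ} (hm : -1 < m.re) {ω : ℝ} (hω : 0 < ω) (R : ℝ) :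
    ∃ D, 0 ≤ D ∧ ∀ t ∈ Ioc 0 R, ‖besselJ m (ω * t)‖ ≤ D * t ^ m.re := by
  obtain ⟨D, hD0, hD⟩ := exists_norm_besselJ_le_rpow_re hm (ω * R)
  refine ⟨D * ω ^ m.re, by positivity, fun t ht => ?_⟩
  have := hD (ω * t) ⟨mul_pos hω ht.1, mul_le_mul_of_nonneg_left ht.2 hω.le⟩
  rwa [Real.mul_rpow hω.le ht.1.le, ← mul_assoc] at this

lemma hasDerivAt_besselJ_comp_mul {m : ℂ} (hm : -1 < m.re) {ω x : ℝ} (hω : 0 < ω) (hx : 0 < x) :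
    HasDerivAt (fun t => besselJ (m + 1) (ω * t))
      (ω * besselJ m (ω * x) - (m + 1) / x * besselJ (m + 1) (ω * x)) x := by
  have h := (hasDerivAt_besselJ_add_one hm (mul_pos hω hx)).scomp x
    ((hasDerivAt_id x).const_mul ω)
  refine h.congr_deriv ?_
  have hxc : (x : ℂ) ≠ 0 := by exact_mod_cast hx.ne'
  have hωc : (ω : ℂ) ≠ 0 := by exact_mod_cast hω.ne'
  simp only [mul_one, Complex.real_smul]
  push_cast
  field_simp

lemma continuousOn_besselJ_comp_mul {m : ℂ} (hm : -1 < m.re) {ω : ℝ} (hω : 0 < ω) :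
    ContinuousOn (fun t => besselJ m (ω * t)) (Ioi 0) :=
  (continuousOn_besselJ hm).comp (by fun_prop) fun _ ht => mul_pos hω ht

lemma intervalIntegrable_mul_besselJ {m : ℂ} (hm : -1 < m.re) {ω R β B : ℝ} (hω : 0 < ω)
    (hR : 0 ≤ R) (hβ : -1 < β + m.re) {p : ℝ → ℝ} (hc : ContinuousOn p (Ioc 0 R))
    (hB : ∀ t ∈ Ioc 0 R, |p t| ≤ B * (t ^ β * (1 + |Real.log t|))) :
    IntervalIntegrable (fun t => (p t : ℂ) * besselJ m (ω * t)) MeasureTheory.volume 0 R := by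
  obtain ⟨D, hD0, hD⟩ := exists_norm_besselJ_mul_le_rpow_re hm hω R
  refine intervalIntegrable_of_norm_le hR hβ (B := B * D) ?_ fun t ht => ?_
  · exact (Complex.continuous_ofReal.comp_continuousOn hc).mul
      ((continuousOn_besselJ_comp_mul hm hω).mono fun _ ht => ht.1)
  · rw [norm_mul, Complex.norm_real, Real.norm_eq_abs]
    calc _ ≤ B * (t ^ β * (1 + |Real.log t|)) * (D * t ^ m.re) :=
          mul_le_mul (hB t ht) (hD t ht) (norm_nonneg _) ((abs_nonneg _).trans (hB t ht))
      _ = _ := by rw [Real.rpow_add ht.1]; ring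

open MeasureTheory in
/-- Integration by parts against a kernel whose primitive is bounded by `C`. -/
lemma norm_integral_mul_le {k : ℝ → ℂ} {φ φ' : ℝ → ℝ} {x B C : ℝ} (hx : 0 < x)
    (hk : IntervalIntegrable k volume 0 x) (hkc : ContinuousOn k (Ioo 0 x))
    (hC : ∀ y ∈ Icc 0 x, ‖∫ t in (0 : ℝ)..y, k t‖ ≤ C)
    (hφ : ∀ t ∈ Ioo 0 x, HasDerivAt φ (φ' t) t) (hφc : ContinuousOn φ (Ioc 0 x))
    (hφB : ∀ t ∈ Ioc 0 x, |φ t| ≤ B) (hφ' : IntervalIntegrable φ' volume 0 x) :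
    IntervalIntegrable (fun t => k t * (φ t : ℂ)) volume 0 x ∧
    ‖∫ t in (0 : ℝ)..x, k t * (φ t : ℂ)‖ ≤ C * (|φ x| + ∫ t in (0 : ℝ)..x, |φ' t|) := by
  have hC0 : 0 ≤ C := (norm_nonneg _).trans (hC 0 ⟨le_rfl, hx.le⟩)
  have hkφ : IntervalIntegrable (fun t => k t * (φ t : ℂ)) volume 0 x := by
    rw [intervalIntegrable_iff_integrableOn_Ioc_of_le hx.le] at hk ⊢
    refine Integrable.mul_bdd (c := B) hk
      ((Complex.continuous_ofReal.comp_continuousOn hφc).aestronglyMeasurable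
      measurableSet_Ioc) ?_
    refine (ae_restrict_iff' measurableSet_Ioc).2 (Filter.Eventually.of_forall fun t ht => ?_)
    rw [Complex.norm_real, Real.norm_eq_abs]
    exact hφB t ht
  refine ⟨hkφ, ?_⟩
  set K : ℝ → ℂ := fun y => ∫ t in (0 : ℝ)..y, k t with hK
  have hKc : ContinuousOn K (Icc 0 x) := by
    have := intervalIntegral.continuousOn_primitive_interval (μ := volume) (f := k) (a := 0)
      (b := x) (by
        rw [uIcc_of_le hx.le, integrableOn_Icc_iff_integrableOn_Ioc]
        rwa [intervalIntegrable_iff_integrableOn_Ioc_of_le hx.le] at hk)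
    rwa [uIcc_of_le hx.le] at this
  have hKd : ∀ y ∈ Ioo 0 x, HasDerivAt K (k y) y := by
    intro y hy
    refine intervalIntegral.integral_hasDerivAt_right (hk.mono_set ?_)
      (hkc.stronglyMeasurableAtFilter isOpen_Ioo y hy) (hkc.continuousAt (isOpen_Ioo.mem_nhds hy))
    rw [uIcc_of_le hx.le, uIcc_of_le hy.1.le]
    exact Icc_subset_Icc_right hy.2.le
  have hφ'c : IntervalIntegrable (fun t => (φ' t : ℂ)) volume 0 x :=
    ⟨hφ'.1.ofReal, hφ'.2.ofReal⟩
  have hKφ' : IntervalIntegrable (fun t => K t * (φ' t : ℂ)) volume 0 x :=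
    hφ'c.continuousOn_mul (by rwa [uIcc_of_le hx.le])
  have hFTC : ∫ t in (0 : ℝ)..x, (k t * (φ t : ℂ) + K t * (φ' t : ℂ)) = K x * φ x - 0 := by
    refine intervalIntegral.integral_eq_sub_of_hasDerivAt_of_tendsto hx
      (f := fun t => K t * (φ t : ℂ)) (fun t ht => (hKd t ht).mul (hφ t ht).ofReal_comp)
      (hkφ.add hKφ') ?_ ?_
    -- At `0` it is enough that `φ` is bounded, because the primitive `K` vanishes there; `φ` needs
    -- no limit.
    · have h0 : Filter.Tendsto K (nhdsWithin 0 (Ioi 0)) (nhds 0) := by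
        have h1 := (hKc 0 ⟨le_rfl, hx.le⟩)
        have e : K 0 = 0 := by simp [hK]
        rw [ContinuousWithinAt, e] at h1
        refine h1.mono_left ?_
        rw [nhdsWithin_le_iff]
        filter_upwards [Ioc_mem_nhdsGT hx] with t ht using ⟨ht.1.le, ht.2⟩
      refine h0.zero_mul_isBoundedUnder_le (Filter.isBoundedUnder_of_eventually_le (a := B) ?_)
      filter_upwards [Ioc_mem_nhdsGT hx] with t ht
      simpa using hφB t ht
    · have h1 := (hKc x ⟨hx.le, le_rfl⟩).mono (s := Ioo 0 x) Ioo_subset_Icc_self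
      have h2 := (hφc x ⟨hx, le_rfl⟩).mono (s := Ioo 0 x) Ioo_subset_Ioc_self
      rw [ContinuousWithinAt, nhdsWithin_Ioo_eq_nhdsLT hx] at h1 h2
      exact h1.mul ((Complex.continuous_ofReal.tendsto _).comp h2)
  rw [intervalIntegral.integral_add hkφ hKφ', sub_zero] at hFTC
  rw [eq_sub_of_add_eq hFTC, mul_add]
  refine (norm_sub_le _ _).trans (add_le_add ?_ ?_)
  · rw [norm_mul, Complex.norm_real, Real.norm_eq_abs]
    exact mul_le_mul_of_nonneg_right (hC x ⟨hx.le, le_rfl⟩) (abs_nonneg _)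
  · rw [← intervalIntegral.integral_const_mul]
    refine intervalIntegral.norm_integral_le_of_norm_le hx.le
      (Filter.Eventually.of_forall fun t ht => ?_) (hφ'.abs.const_mul C)
    rw [norm_mul, Complex.norm_real, Real.norm_eq_abs]
    exact mul_le_mul_of_nonneg_right (hC t ⟨ht.1.le, ht.2⟩) (abs_nonneg _)

/-! ### Oscillatory integrals of the Bessel function -/

open MeasureTheory in
-- On `[0, 1]` the integrand is absolutely integrable. Beyond `1`, `J_m = J_{m+1}' + (m + 1) / u ·
-- J_{m+1}` is integrated by parts: the new amplitude is `O(u ^ (-3/4))` and `J_{m+1} = O(u ^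
-- (-1/2))`, so the remainder is `O(u ^ (-5/4))`, whose integral over `[1, ∞)` is the `4` below. The
-- growth `u ^ (1/4)` allowed for `p` leaves room for a logarithm.
lemma exists_norm_integral_mul_besselJ_le {m : ℂ} (hm : -1 < m.re) {β A : ℝ}
    (hβ : -1 < β + m.re) {p p' : ℝ → ℝ} (hp : ∀ u, 0 < u → HasDerivAt p (p' u) u)
    (hp'c : ContinuousOn p' (Ioi 0))
    (hp0 : ∀ u ∈ Ioc (0 : ℝ) 1, |p u| ≤ A * (u ^ β * (1 + |Real.log u|)))
    (hp1 : ∀ u, 1 ≤ u → |p u| ≤ A * u ^ (1 / 4 : ℝ))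
    (hp'1 : ∀ u, 1 ≤ u → |p' u| ≤ A * u ^ (-(3 / 4) : ℝ)) :
    ∃ C, 0 ≤ C ∧ ∀ X, 0 ≤ X → ‖∫ u in (0 : ℝ)..X, (p u : ℂ) * besselJ m u‖ ≤ C := by
  have hm1 : -1 < (m + 1).re := by simp; linarith
  obtain ⟨D, hD0, hD⟩ := exists_norm_besselJ_le_rpow hm1
  have hA0 : 0 ≤ A := by simpa using (abs_nonneg _).trans (hp1 1 le_rfl)
  have hpc : ContinuousOn p (Ioi 0) := fun u hu => (hp u hu).continuousAt.continuousWithinAt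
  have hint0 : IntervalIntegrable (fun u => (p u : ℂ) * besselJ m u) volume 0 1 := by
    have := intervalIntegrable_mul_besselJ hm one_pos zero_le_one hβ
      (hpc.mono fun _ ht => ht.1) hp0
    simpa using this
  set I0 := ∫ u in (0 : ℝ)..1, ‖(p u : ℂ) * besselJ m u‖ with hI0
  have hI00 : 0 ≤ I0 := intervalIntegral.integral_nonneg zero_le_one fun _ _ => norm_nonneg _
  set M := A * (1 + ‖m + 1‖) * D with hM
  have hM0 : 0 ≤ M := by positivity
  have hbd : ∀ u, 1 ≤ u → ‖(p u : ℂ) * besselJ (m + 1) u‖ ≤ A * D := by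
    intro u hu
    rw [norm_mul, Complex.norm_real, Real.norm_eq_abs]
    calc _ ≤ (A * u ^ (1 / 4 : ℝ)) * (D * u ^ (-(1 / 2) : ℝ)) :=
          mul_le_mul (hp1 u hu) (hD u hu) (norm_nonneg _) (by positivity)
      _ = A * D * u ^ (1 / 4 + -(1 / 2) : ℝ) := by
          rw [Real.rpow_add (one_pos.trans_le hu)]; ring
      _ ≤ A * D * 1 := by
          gcongr
          exact Real.rpow_le_one_of_one_le_of_nonpos hu (by norm_num)
      _ = _ := mul_one _
  refine ⟨I0 + (A * D + A * D + M * 4), by positivity, fun X hX => ?_⟩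
  rcases le_total X 1 with hX1 | hX1
  · calc _ ≤ ∫ u in (0 : ℝ)..X, ‖(p u : ℂ) * besselJ m u‖ :=
          intervalIntegral.norm_integral_le_integral_norm hX
      _ ≤ I0 := intervalIntegral.integral_mono_interval le_rfl hX hX1
          (Filter.Eventually.of_forall fun _ => norm_nonneg _) hint0.norm
      _ ≤ _ := le_add_of_nonneg_right (by positivity)
  have hsub : uIcc 1 X ⊆ Ioi 0 := by
    rw [uIcc_of_le hX1]; exact fun u hu => one_pos.trans_le hu.1
  have hcp : ContinuousOn (fun u => (p u : ℂ)) (Ioi 0) :=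
    Complex.continuous_ofReal.comp_continuousOn hpc
  have hcp' : ContinuousOn (fun u => (p' u : ℂ)) (Ioi 0) :=
    Complex.continuous_ofReal.comp_continuousOn hp'c
  have hint1 : IntervalIntegrable (fun u => (p u : ℂ) * besselJ m u) volume 1 X :=
    ((hcp.mul (continuousOn_besselJ hm)).mono hsub).intervalIntegrable
  have hdivc : ContinuousOn (fun u : ℝ => (m + 1) / (u : ℂ)) (Ioi 0) :=
    continuousOn_const.div Complex.continuous_ofReal.continuousOn
      fun u hu => by exact_mod_cast (ne_of_gt hu)
  have hint2 : IntervalIntegrable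
      (fun u => ((p' u : ℂ) - (m + 1) / u * p u) * besselJ (m + 1) u) volume 1 X :=
    (((hcp'.sub (hdivc.mul hcp)).mul (continuousOn_besselJ hm1)).mono hsub).intervalIntegrable
  have hFTC := intervalIntegral.integral_eq_sub_of_hasDerivAt
    (f := fun u => (p u : ℂ) * besselJ (m + 1) u)
    (f' := fun u => (p u : ℂ) * besselJ m u +
      ((p' u : ℂ) - (m + 1) / u * p u) * besselJ (m + 1) u) (a := 1) (b := X) (fun u hu => by
      refine ((hp u (hsub hu)).ofReal_comp.mul
        (hasDerivAt_besselJ_add_one hm (hsub hu))).congr_deriv ?_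
      ring) (hint1.add hint2)
  rw [intervalIntegral.integral_add hint1 hint2] at hFTC
  have h2 : ‖∫ u in (1 : ℝ)..X, ((p' u : ℂ) - (m + 1) / u * p u) * besselJ (m + 1) u‖ ≤
      ∫ u in (1 : ℝ)..X, M * u ^ (-(5 / 4) : ℝ) := by
    refine intervalIntegral.norm_integral_le_of_norm_le hX1
      (Filter.Eventually.of_forall fun u hu => ?_) ?_
    · have hu1 : 1 ≤ u := hu.1.le
      have hu0 : 0 < u := one_pos.trans hu.1
      have e1 : u ^ (1 / 4 : ℝ) / u = u ^ (-(3 / 4) : ℝ) := by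
        conv_lhs => rw [← Real.rpow_sub_one hu0.ne']
        norm_num
      have h3 : ‖(p' u : ℂ) - (m + 1) / u * p u‖ ≤ A * (1 + ‖m + 1‖) * u ^ (-(3 / 4) : ℝ) := by
        refine (norm_sub_le _ _).trans ?_
        rw [norm_mul, norm_div, Complex.norm_real, Complex.norm_real, Complex.norm_real,
          Real.norm_eq_abs, Real.norm_eq_abs, Real.norm_eq_abs, abs_of_pos hu0]
        calc _ ≤ A * u ^ (-(3 / 4) : ℝ) + ‖m + 1‖ / u * (A * u ^ (1 / 4 : ℝ)) :=
              add_le_add (hp'1 u hu1) (by gcongr; exact hp1 u hu1)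
          _ = A * u ^ (-(3 / 4) : ℝ) + ‖m + 1‖ * A * (u ^ (1 / 4 : ℝ) / u) := by ring
          _ = _ := by rw [e1]; ring
      rw [norm_mul]
      calc _ ≤ (A * (1 + ‖m + 1‖) * u ^ (-(3 / 4) : ℝ)) * (D * u ^ (-(1 / 2) : ℝ)) :=
            mul_le_mul h3 (hD u hu1) (norm_nonneg _) (by positivity)
        _ = M * (u ^ (-(3 / 4) : ℝ) * u ^ (-(1 / 2) : ℝ)) := by rw [hM]; ring
        _ = _ := by rw [← Real.rpow_add hu0]; norm_num
    · refine (intervalIntegral.intervalIntegrable_rpow (Or.inr fun h => ?_)).const_mul M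
      exact lt_irrefl (0 : ℝ) (hsub h)
  have h3 : ∫ u in (1 : ℝ)..X, M * u ^ (-(5 / 4) : ℝ) ≤ M * 4 := by
    rw [intervalIntegral.integral_const_mul,
      integral_rpow (Or.inr ⟨by norm_num, fun h => lt_irrefl (0 : ℝ) (hsub h)⟩)]
    gcongr
    have : 0 ≤ X ^ (-(5 / 4) + 1 : ℝ) := by positivity
    rw [Real.one_rpow, div_le_iff_of_neg (by norm_num)]
    linarith
  rw [← intervalIntegral.integral_add_adjacent_intervals hint0 hint1, eq_sub_of_add_eq hFTC]
  refine (norm_add_le _ _).trans (add_le_add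
    (intervalIntegral.norm_integral_le_integral_norm zero_le_one) ?_)
  refine (norm_sub_le _ _).trans (add_le_add ((norm_sub_le _ _).trans (add_le_add ?_ ?_))
    (h2.trans h3))
  · exact hbd X hX1
  · exact hbd 1 le_rfl

lemma hasDerivAt_rpow_mul_log {α u : ℝ} (hu : 0 < u) :
    HasDerivAt (fun u : ℝ => u ^ α * Real.log u)
      (α * u ^ (α - 1) * Real.log u + u ^ (α - 1)) u := by
  refine ((Real.hasDerivAt_rpow_const (Or.inl hu.ne')).mul (Real.hasDerivAt_log hu.ne')).congr_deriv
    ?_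
  rw [Real.rpow_sub_one hu.ne']
  field_simp

lemma continuousOn_rpow_Ioi (α : ℝ) : ContinuousOn (fun u : ℝ => u ^ α) (Ioi 0) :=
  fun _ hu => (Real.continuousAt_rpow_const _ _ (Or.inl (ne_of_gt hu))).continuousWithinAt

lemma continuousOn_log_Ioi : ContinuousOn Real.log (Ioi 0) :=
  Real.continuousOn_log.mono fun _ hu => ne_of_gt hu

lemma exists_norm_integral_rpow_mul_besselJ_le {m : ℂ} (hm : -1 < m.re) {α : ℝ} (hα : α ≤ 0)
    (hαm : -1 < α + m.re) :
    ∃ C, 0 ≤ C ∧ ∀ X, 0 ≤ X → ‖∫ u in (0 : ℝ)..X, ((u ^ α : ℝ) : ℂ) * besselJ m u‖ ≤ C := by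
  refine exists_norm_integral_mul_besselJ_le hm hαm (A := |α| + 1)
    (p' := fun u => α * u ^ (α - 1))
    (fun u hu => Real.hasDerivAt_rpow_const (Or.inl hu.ne'))
    (continuousOn_const.mul (continuousOn_rpow_Ioi _)) (fun u hu => ?_) (fun u hu => ?_)
    (fun u hu => ?_)
  · have := Real.rpow_pos_of_pos hu.1 α
    rw [abs_of_pos this]
    nlinarith [abs_nonneg α, mul_nonneg this.le (abs_nonneg (Real.log u)),
      mul_nonneg (abs_nonneg α) (mul_nonneg this.le (abs_nonneg (Real.log u))),
      mul_nonneg (abs_nonneg α) this.le]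
  · have hu0 : 0 < u := one_pos.trans_le hu
    rw [abs_of_pos (Real.rpow_pos_of_pos hu0 α)]
    have h1 : u ^ α ≤ u ^ (1 / 4 : ℝ) := Real.rpow_le_rpow_of_exponent_le hu (by linarith)
    nlinarith [abs_nonneg α, Real.rpow_pos_of_pos hu0 (1 / 4 : ℝ)]
  · have hu0 : 0 < u := one_pos.trans_le hu
    rw [abs_mul, abs_of_pos (Real.rpow_pos_of_pos hu0 (α - 1))]
    have h1 : u ^ (α - 1) ≤ u ^ (-(3 / 4) : ℝ) :=
      Real.rpow_le_rpow_of_exponent_le hu (by linarith)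
    have := Real.rpow_pos_of_pos hu0 (-(3 / 4) : ℝ)
    calc _ ≤ |α| * u ^ (-(3 / 4) : ℝ) := by gcongr
      _ ≤ _ := by gcongr; linarith

lemma exists_norm_integral_rpow_mul_log_mul_besselJ_le {m : ℂ} (hm : -1 < m.re) {α : ℝ}
    (hα : α ≤ 0) (hαm : -1 < α + m.re) :
    ∃ C, 0 ≤ C ∧ ∀ X, 0 ≤ X →
      ‖∫ u in (0 : ℝ)..X, ((u ^ α * Real.log u : ℝ) : ℂ) * besselJ m u‖ ≤ C := by
  have hlog : ∀ u : ℝ, 1 ≤ u → |Real.log u| ≤ 4 * u ^ (1 / 4 : ℝ) := by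
    intro u hu
    rw [abs_of_nonneg (Real.log_nonneg hu)]
    have := Real.log_le_rpow_div (x := u) (ε := 1 / 4) (by linarith) (by norm_num)
    linarith
  refine exists_norm_integral_mul_besselJ_le hm hαm (A := 4 * |α| + 4)
    (p' := fun u => α * u ^ (α - 1) * Real.log u + u ^ (α - 1))
    (fun u hu => hasDerivAt_rpow_mul_log hu)
    (((continuousOn_const.mul (continuousOn_rpow_Ioi _)).mul continuousOn_log_Ioi).add
      (continuousOn_rpow_Ioi _)) (fun u hu => ?_) (fun u hu => ?_) (fun u hu => ?_)
  · have hp := Real.rpow_pos_of_pos hu.1 α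
    rw [abs_mul, abs_of_pos hp]
    calc u ^ α * |Real.log u| ≤ 1 * (u ^ α * (1 + |Real.log u|)) := by
          rw [one_mul]; gcongr; linarith
      _ ≤ _ := by gcongr; linarith [abs_nonneg α]
  · have hu0 : 0 < u := one_pos.trans_le hu
    rw [abs_mul, abs_of_pos (Real.rpow_pos_of_pos hu0 α)]
    have h1 : u ^ α ≤ 1 := Real.rpow_le_one_of_one_le_of_nonpos hu hα
    have := Real.rpow_pos_of_pos hu0 (1 / 4 : ℝ)
    calc _ ≤ 1 * (4 * u ^ (1 / 4 : ℝ)) := by gcongr; exact hlog u hu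
      _ = 4 * u ^ (1 / 4 : ℝ) := one_mul _
      _ ≤ _ := by gcongr; linarith [abs_nonneg α]
  · have hu0 : 0 < u := one_pos.trans_le hu
    have hp := Real.rpow_pos_of_pos hu0 (α - 1)
    have h1 : u ^ (α - 1) ≤ u ^ (-1 : ℝ) := Real.rpow_le_rpow_of_exponent_le hu (by linarith)
    have h2 : u ^ (-1 : ℝ) ≤ u ^ (-(3 / 4) : ℝ) :=
      Real.rpow_le_rpow_of_exponent_le hu (by norm_num)
    have h3 : u ^ (-1 : ℝ) * u ^ (1 / 4 : ℝ) = u ^ (-(3 / 4) : ℝ) := by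
      rw [← Real.rpow_add hu0]; norm_num
    have h4 := Real.rpow_pos_of_pos hu0 (-(3 / 4) : ℝ)
    refine (abs_add_le _ _).trans ?_
    rw [abs_mul, abs_mul, abs_of_pos hp]
    calc _ ≤ |α| * u ^ (-1 : ℝ) * (4 * u ^ (1 / 4 : ℝ)) + u ^ (-(3 / 4) : ℝ) := by
          refine add_le_add (mul_le_mul (by gcongr) (hlog u hu) (abs_nonneg _) ?_) (h1.trans h2)
          exact mul_nonneg (abs_nonneg α) (hp.le.trans h1)
      _ = (4 * |α| + 1) * u ^ (-(3 / 4) : ℝ) := by rw [← h3]; ring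
      _ ≤ _ := by gcongr; norm_num

/-! ### The rates `C₁` and `C₂` -/

open MeasureTheory in
/-- For `α > 0` the oscillation of the bare Bessel kernel gives the rate `1 / ω`. -/
lemma exists_norm_integral_le_div {m : ℂ} (hm : -1 < m.re) {α b B : ℝ} (hα : 0 < α) (hb : 0 < b)
    {p p' : ℝ → ℝ} (hp : ∀ u, 0 < u → HasDerivAt p (p' u) u)
    (hp'c : ContinuousOn p' (Ioi 0)) (hpB : ∀ t ∈ Ioc 0 b, |p t| ≤ B)
    (hp'B : ∀ t ∈ Ioc 0 b, |p' t| ≤ B * (t ^ (α - 1) * (1 + |Real.log t|))) :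
    ∃ C, 0 ≤ C ∧ ∀ ω, 1 ≤ ω → ∀ x ∈ Icc 0 b,
      ‖∫ t in (0 : ℝ)..x, (p t : ℂ) * besselJ m (ω * t)‖ ≤ C / ω := by
  obtain ⟨C, hC0, hC⟩ := exists_norm_integral_rpow_mul_besselJ_le hm le_rfl (by simpa using hm)
  have hp'int : IntervalIntegrable p' volume 0 b :=
    intervalIntegrable_of_norm_le hb.le (by linarith) (hp'c.mono fun _ ht => ht.1) hp'B
  have hB0 : 0 ≤ B := (abs_nonneg _).trans (hpB b ⟨hb, le_rfl⟩)
  have hI0 : 0 ≤ ∫ t in (0 : ℝ)..b, |p' t| :=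
    intervalIntegral.integral_nonneg hb.le fun _ _ => abs_nonneg _
  refine ⟨C * (B + ∫ t in (0 : ℝ)..b, |p' t|), by positivity, fun ω hω x hx => ?_⟩
  have hω0 : 0 < ω := one_pos.trans_le hω
  rcases hx.1.eq_or_lt with rfl | hx0
  · simp only [intervalIntegral.integral_same, norm_zero]; positivity
  have hsub : ∀ t ∈ Ioc 0 x, t ∈ Ioc 0 b := fun t ht => ⟨ht.1, ht.2.trans hx.2⟩
  have hk : IntervalIntegrable (fun t => besselJ m (ω * t)) volume 0 x := by
    have := intervalIntegrable_mul_besselJ (p := fun _ => 1) (B := 1) (β := 0) hm hω0 hx0.le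
      (by simpa using hm) continuousOn_const (fun t _ => by simp)
    simpa using this
  have hkC : ∀ y ∈ Icc 0 x, ‖∫ t in (0 : ℝ)..y, besselJ m (ω * t)‖ ≤ C / ω := by
    intro y hy
    have h := hC (ω * y) (mul_nonneg hω0.le hy.1)
    simp only [Real.rpow_zero, Complex.ofReal_one, one_mul] at h
    rw [intervalIntegral.integral_comp_mul_left _ hω0.ne', norm_smul, norm_inv, Real.norm_eq_abs,
      abs_of_pos hω0, mul_zero, div_eq_inv_mul]
    gcongr
  have h := (norm_integral_mul_le (φ := p) (φ' := p') (B := B) hx0 hk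
    ((continuousOn_besselJ_comp_mul hm hω0).mono fun _ ht => ht.1) hkC (fun t ht => hp t ht.1)
    (fun t ht => (hp t ht.1).continuousAt.continuousWithinAt) (fun t ht => hpB t (hsub t ht))
    (hp'int.mono_set (by
      rw [uIcc_of_le hx0.le, uIcc_of_le hb.le]; exact Icc_subset_Icc_right hx.2))).2
  have h1 : ∫ t in (0 : ℝ)..x, |p' t| ≤ ∫ t in (0 : ℝ)..b, |p' t| :=
    intervalIntegral.integral_mono_interval le_rfl hx0.le hx.2
      (Filter.Eventually.of_forall fun _ => abs_nonneg _) hp'int.abs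
  have h2 := hpB x ⟨hx0, hx.2⟩
  simp_rw [mul_comm (p _ : ℂ)]
  calc _ ≤ C / ω * (|p x| + ∫ t in (0 : ℝ)..x, |p' t|) := h
    _ ≤ C / ω * (B + ∫ t in (0 : ℝ)..b, |p' t|) := by gcongr
    _ = _ := by ring

lemma rpow_mul_integral_rpow_mul_besselJ (m : ℂ) (α : ℝ) {ω : ℝ} (hω : 0 < ω) {x : ℝ}
    (hx : 0 ≤ x) :
    ((ω ^ (α + 1) : ℝ) : ℂ) * ∫ t in (0 : ℝ)..x, ((t ^ α : ℝ) : ℂ) * besselJ m (ω * t) =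
      ∫ u in (0 : ℝ)..(ω * x), ((u ^ α : ℝ) : ℂ) * besselJ m u := by
  have h := intervalIntegral.integral_comp_mul_left (a := 0) (b := x)
    (fun u : ℝ => ((u ^ α : ℝ) : ℂ) * besselJ m u) hω.ne'
  rw [eq_inv_smul_iff₀ hω.ne', mul_zero] at h
  rw [← h, ← intervalIntegral.integral_const_mul, ← intervalIntegral.integral_smul]
  refine intervalIntegral.integral_congr_ae (Filter.Eventually.of_forall fun t ht => ?_)
  rw [uIoc_of_le hx] at ht
  rw [Real.mul_rpow hω.le ht.1.le, Real.rpow_add_one hω.ne', Complex.real_smul]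
  push_cast
  ring

open MeasureTheory in
-- Under `u = ω t` one has `ln t = ln u - ln ω`, which is the source of the factor `1 + ln ω` in the
-- rates.
lemma rpow_mul_integral_rpow_mul_log_mul_besselJ {m : ℂ} (hm : -1 < m.re) {α : ℝ}
    (hαm : -1 < α + m.re) {ω : ℝ} (hω : 0 < ω) {x : ℝ} (hx : 0 ≤ x) :
    ((ω ^ (α + 1) : ℝ) : ℂ) *
        ∫ t in (0 : ℝ)..x, ((t ^ α * Real.log t : ℝ) : ℂ) * besselJ m (ω * t) =
      (∫ u in (0 : ℝ)..(ω * x), ((u ^ α * Real.log u : ℝ) : ℂ) * besselJ m u) -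
        Real.log ω * ∫ u in (0 : ℝ)..(ω * x), ((u ^ α : ℝ) : ℂ) * besselJ m u := by
  have h := intervalIntegral.integral_comp_mul_left (a := 0) (b := x)
    (fun u : ℝ => ((u ^ α * Real.log u : ℝ) : ℂ) * besselJ m u) hω.ne'
  rw [eq_inv_smul_iff₀ hω.ne', mul_zero] at h
  have i1 : IntervalIntegrable (fun t => ((t ^ α * Real.log t : ℝ) : ℂ) * besselJ m (ω * t))
      volume 0 x := by
    refine intervalIntegrable_mul_besselJ (B := 1) hm hω hx hαm
      (((continuousOn_rpow_Ioi α).mul continuousOn_log_Ioi).mono fun _ ht => ht.1)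
      fun t ht => ?_
    rw [abs_mul, abs_of_pos (Real.rpow_pos_of_pos ht.1 α), one_mul]
    have := Real.rpow_pos_of_pos ht.1 α
    gcongr
    linarith
  have i2 : IntervalIntegrable (fun t => ((t ^ α : ℝ) : ℂ) * besselJ m (ω * t)) volume 0 x := by
    refine intervalIntegrable_mul_besselJ (B := 1) hm hω hx hαm
      ((continuousOn_rpow_Ioi α).mono fun _ ht => ht.1) fun t ht => ?_
    have := Real.rpow_pos_of_pos ht.1 α
    rw [abs_of_pos this, one_mul]
    exact le_mul_of_one_le_right this.le (by linarith [abs_nonneg (Real.log t)])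
  rw [← rpow_mul_integral_rpow_mul_besselJ m α hω hx, ← h, eq_sub_iff_add_eq,
    ← intervalIntegral.integral_smul, ← intervalIntegral.integral_const_mul,
    ← intervalIntegral.integral_const_mul, ← intervalIntegral.integral_const_mul,
    ← intervalIntegral.integral_add (i1.const_mul _) ((i2.const_mul _).const_mul _)]
  refine intervalIntegral.integral_congr_ae (Filter.Eventually.of_forall fun t ht => ?_)
  rw [uIoc_of_le hx] at ht
  rw [Real.mul_rpow hω.le ht.1.le, Real.rpow_add_one hω.ne', Complex.real_smul,
    Real.log_mul hω.ne' ht.1.ne']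
  push_cast
  ring

lemma exists_norm_integral_le_C₁ {m : ℂ} (hm : -1 < m.re) {α b : ℝ} (hb : 0 < b)
    (hαm : -1 < α + m.re) :
    ∃ c, 0 < c ∧ ∀ ω, 1 ≤ ω → ∀ x ∈ Icc 0 b,
      ‖∫ t in (0 : ℝ)..x, ((t ^ α : ℝ) : ℂ) * besselJ m (ω * t)‖ ≤ C₁ c c α ω := by
  rcases le_or_gt α 0 with hα | hα
  · obtain ⟨C, hC0, hC⟩ := exists_norm_integral_rpow_mul_besselJ_le hm hα hαm
    refine ⟨C + 1, by positivity, fun ω hω x hx => ?_⟩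
    have hω0 : 0 < ω := one_pos.trans_le hω
    have hp := Real.rpow_pos_of_pos hω0 (α + 1)
    have h := hC (ω * x) (mul_nonneg hω0.le hx.1)
    rw [← rpow_mul_integral_rpow_mul_besselJ m α hω0 hx.1, norm_mul, Complex.norm_real,
      Real.norm_eq_abs, abs_of_pos hp] at h
    -- At `α = 0` the two branches of `C₁` coincide.
    have e : C₁ (C + 1) (C + 1) α ω = (C + 1) / ω ^ (α + 1) := by
      rw [C₁]
      split_ifs with h0
      · rfl
      · have : α = 0 := le_antisymm hα (not_lt.1 h0)
        simp [this]
    rw [e, le_div_iff₀ hp]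
    linarith
  · obtain ⟨C, hC0, hC⟩ := exists_norm_integral_le_div (α := α) (B := b ^ α + α) hm hα hb
      (p := fun t => t ^ α) (p' := fun t => α * t ^ (α - 1))
      (fun u hu => Real.hasDerivAt_rpow_const (Or.inl hu.ne'))
      (continuousOn_const.mul (continuousOn_rpow_Ioi _)) (fun t ht => by
        rw [abs_of_pos (Real.rpow_pos_of_pos ht.1 α)]
        have := Real.rpow_le_rpow ht.1.le ht.2 hα.le
        linarith) (fun t ht => by
        have hp := Real.rpow_pos_of_pos ht.1 (α - 1)
        have hbp := Real.rpow_pos_of_pos hb α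
        rw [abs_of_pos (by positivity)]
        refine mul_le_mul (by linarith) ?_ hp.le (by positivity)
        exact le_mul_of_one_le_right hp.le (by linarith [abs_nonneg (Real.log t)]))
    refine ⟨C + 1, by positivity, fun ω hω x hx => ?_⟩
    have hω0 : 0 < ω := one_pos.trans_le hω
    rw [C₁, if_neg (not_lt.2 hα.le)]
    refine (hC ω hω x hx).trans ?_
    gcongr
    linarith

/-- Scaling covers `α ≤ 0`, so the logarithm persists at `α = 0`; for `α > 0` the weight `t ^ α ln
t` is bounded with integrable derivative and the logarithm in `ω` disappears. -/
lemma exists_norm_integral_le_C₂log {m : ℂ} (hm : -1 < m.re) {α b : ℝ} (hb : 0 < b)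
    (hαm : -1 < α + m.re) :
    ∃ c, 0 < c ∧ ∀ ω, 1 ≤ ω → ∀ x ∈ Icc 0 b,
      ‖∫ t in (0 : ℝ)..x, ((t ^ α * Real.log t : ℝ) : ℂ) * besselJ m (ω * t)‖ ≤
        C₂log c c α ω := by
  rcases le_or_gt α 0 with hα | hα
  · obtain ⟨C, hC0, hC⟩ := exists_norm_integral_rpow_mul_besselJ_le hm hα hαm
    obtain ⟨D, hD0, hD⟩ := exists_norm_integral_rpow_mul_log_mul_besselJ_le hm hα hαm
    refine ⟨C + D + 1, by positivity, fun ω hω x hx => ?_⟩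
    have hω0 : 0 < ω := one_pos.trans_le hω
    have hp := Real.rpow_pos_of_pos hω0 (α + 1)
    have hl := Real.log_nonneg hω
    have h1 := hC (ω * x) (mul_nonneg hω0.le hx.1)
    have h2 := hD (ω * x) (mul_nonneg hω0.le hx.1)
    have h := congrArg norm (rpow_mul_integral_rpow_mul_log_mul_besselJ hm hαm hω0 hx.1)
    rw [norm_mul, Complex.norm_real, Real.norm_eq_abs, abs_of_pos hp] at h
    rw [C₂log, if_pos hα, le_div_iff₀ hp, mul_comm, h]
    refine (norm_sub_le _ _).trans ?_
    rw [norm_mul, Complex.norm_real, Real.norm_eq_abs, abs_of_nonneg hl]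
    calc _ ≤ D + Real.log ω * C := by gcongr
      _ ≤ _ := by nlinarith
  · obtain ⟨D, hD0, hD⟩ := exists_abs_log_le_rpow hα b
    obtain ⟨C, hC0, hC⟩ := exists_norm_integral_le_div (α := α) (B := D + α + 1) hm hα hb
      (p := fun t => t ^ α * Real.log t)
      (p' := fun u => α * u ^ (α - 1) * Real.log u + u ^ (α - 1))
      (fun u hu => hasDerivAt_rpow_mul_log hu)
      (((continuousOn_const.mul (continuousOn_rpow_Ioi _)).mul continuousOn_log_Ioi).add
      (continuousOn_rpow_Ioi _)) (fun t ht => by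
        have hp := Real.rpow_pos_of_pos ht.1 α
        rw [abs_mul, abs_of_pos hp]
        calc _ ≤ t ^ α * (D * t ^ (-α)) := by gcongr; exact hD t ht
          _ = D * (t ^ α * t ^ (-α)) := by ring
          _ = D := by rw [← Real.rpow_add ht.1]; simp
          _ ≤ _ := by linarith) (fun t ht => by
        have hp := Real.rpow_pos_of_pos ht.1 (α - 1)
        refine (abs_add_le _ _).trans ?_
        rw [abs_mul, abs_mul, abs_of_pos hp, abs_of_pos hα]
        have hl := abs_nonneg (Real.log t)
        calc _ = t ^ (α - 1) * (α * |Real.log t| + 1) := by ring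
          _ ≤ t ^ (α - 1) * ((D + α + 1) * (1 + |Real.log t|)) := by
            gcongr
            nlinarith [mul_nonneg hD0 hl]
          _ = _ := by ring)
    refine ⟨C + 1, by positivity, fun ω hω x hx => ?_⟩
    have hω0 : 0 < ω := one_pos.trans_le hω
    rw [C₂log, if_neg (not_le.2 hα)]
    refine (hC ω hω x hx).trans ?_
    gcongr
    linarith

lemma C₁_mono {c d : ℝ} (h : c ≤ d) (α : ℝ) {ω : ℝ} (hω : 1 ≤ ω) : C₁ c c α ω ≤ C₁ d d α ω := by
  have hω0 : 0 < ω := one_pos.trans_le hω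
  have := Real.rpow_pos_of_pos hω0 (α + 1)
  rw [C₁, C₁]
  split_ifs <;> gcongr

lemma C₂log_mono {c d : ℝ} (h : c ≤ d) (α : ℝ) {ω : ℝ} (hω : 1 ≤ ω) :
    C₂log c c α ω ≤ C₂log d d α ω := by
  have hω0 : 0 < ω := one_pos.trans_le hω
  have := Real.rpow_pos_of_pos hω0 (α + 1)
  have := Real.log_nonneg hω
  rw [C₂log, C₂log]
  split_ifs <;> gcongr

/-- The kernels with weight `t ^ (α + 1) ln t` decay like `1 / ω` whatever `α` is; this weakens that
rate to `C₂`. -/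
lemma div_le_C₂ {c : ℝ} (hc : 0 ≤ c) (α : ℝ) {ω : ℝ} (hω : 1 ≤ ω) : c / ω ≤ C₂ c c α ω := by
  have hω0 : 0 < ω := one_pos.trans_le hω
  have hp := Real.rpow_pos_of_pos hω0 (α + 1)
  have hl := Real.log_nonneg hω
  rw [C₂]
  split_ifs with h
  · have h1 : ω ^ (α + 1) ≤ ω := by
      calc ω ^ (α + 1) ≤ ω ^ (1 : ℝ) := Real.rpow_le_rpow_of_exponent_le hω (by linarith)
        _ = ω := Real.rpow_one ω
    gcongr
    nlinarith
  · exact le_rfl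

lemma exists_kernel_bound {m : ℂ} (hm : -1 < m.re) {α b : ℝ} (hb : 0 < b) (hα : -1 < α) :
    ∃ c, 0 < c ∧ ∀ ω, 1 ≤ ω → ∀ x ∈ Icc 0 b,
      ‖∫ t in (0 : ℝ)..x, ((t ^ α : ℝ) : ℂ) * besselJ (m + 1) (ω * t)‖ ≤ C₁ c c α ω ∧
      ‖∫ t in (0 : ℝ)..x, ((t ^ α * Real.log t : ℝ) : ℂ) * besselJ (m + 1) (ω * t)‖ ≤
        C₂log c c α ω ∧
      ‖∫ t in (0 : ℝ)..x, ((t ^ (α + 1) * Real.log t : ℝ) : ℂ) * besselJ m (ω * t)‖ ≤ c / ω ∧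
      ‖∫ t in (0 : ℝ)..x, ((t ^ (α + 1) * Real.log t : ℝ) : ℂ) * besselJ (m + 1) (ω * t)‖ ≤
        c / ω := by
  have hm1 : -1 < (m + 1).re := by simp; linarith
  have e : (m + 1).re = m.re + 1 := by simp
  obtain ⟨c₁, h1, H1⟩ := exists_norm_integral_le_C₁ hm1 (α := α) hb (by linarith)
  obtain ⟨c₂, h2, H2⟩ := exists_norm_integral_le_C₂log hm1 (α := α) hb (by linarith)
  obtain ⟨c₃, h3, H3⟩ := exists_norm_integral_le_C₂log hm (α := α + 1) hb (by linarith)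
  obtain ⟨c₄, h4, H4⟩ := exists_norm_integral_le_C₂log hm1 (α := α + 1) hb (by linarith)
  refine ⟨c₁ + c₂ + c₃ + c₄, by positivity, fun ω hω x hx => ?_⟩
  have hω0 : 0 < ω := one_pos.trans_le hω
  have e2 : ∀ c, C₂log c c (α + 1) ω = c / ω := fun c => by
    rw [C₂log, if_neg (by linarith)]
  refine ⟨(H1 ω hω x hx).trans (C₁_mono (by linarith) α hω),
    (H2 ω hω x hx).trans (C₂log_mono (by linarith) α hω), ?_, ?_⟩
  · refine ((H3 ω hω x hx).trans (C₂log_mono (?_ : c₃ ≤ c₁ + c₂ + c₃ + c₄) _ hω)).trans_eq (e2 _)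
    linarith
  · refine ((H4 ω hω x hx).trans (C₂log_mono (?_ : c₄ ≤ c₁ + c₂ + c₃ + c₄) _ hω)).trans_eq (e2 _)
    linarith

/-! ### The error functional -/

lemma abs_le_mul_of_abs_deriv_le {q q' : ℝ → ℝ} {t M : ℝ} (ht : 0 < t)
    (hc : ContinuousOn q (Icc 0 t)) (hd : ∀ s ∈ Ioo 0 t, HasDerivAt q (q' s) s)
    (hM : ∀ s ∈ Ioo 0 t, |q' s| ≤ M) (h0 : q 0 = 0) : |q t| ≤ M * t := by
  obtain ⟨s, hs, he⟩ := exists_hasDerivAt_eq_slope q q' ht hc hd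
  have := hM s hs
  rw [he, h0, sub_zero, sub_zero, abs_div, abs_of_pos ht] at this
  rwa [div_le_iff₀ ht] at this

/-- `g₀ ∈ C³[0, b]` vanishes at both endpoints and has the derivatives `g₁, g₂, g₃`, the last two
bounded by `D₂, D₃`. -/
structure IsError (b : ℝ) (g₀ g₁ g₂ g₃ : ℝ → ℝ) (D₂ D₃ : ℝ) : Prop where
  pos : 0 < b
  zero : g₀ 0 = 0
  right : g₀ b = 0
  cont₀ : ContinuousOn g₀ (Icc 0 b)
  cont₁ : ContinuousOn g₁ (Icc 0 b)
  cont₂ : ContinuousOn g₂ (Icc 0 b)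
  cont₃ : ContinuousOn g₃ (Icc 0 b)
  deriv₀ : ∀ x ∈ Ioo 0 b, HasDerivAt g₀ (g₁ x) x
  deriv₁ : ∀ x ∈ Ioo 0 b, HasDerivAt g₁ (g₂ x) x
  deriv₂ : ∀ x ∈ Ioo 0 b, HasDerivAt g₂ (g₃ x) x
  bound₂ : ∀ x ∈ Icc 0 b, |g₂ x| ≤ D₂
  bound₃ : ∀ x ∈ Icc 0 b, |g₃ x| ≤ D₃

namespace IsError

variable {b D₂ D₃ : ℝ} {g₀ g₁ g₂ g₃ : ℝ → ℝ}

/-- The first derivative of `g₀ x / x`. -/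
noncomputable def quot₁ (g₀ g₁ : ℝ → ℝ) (x : ℝ) : ℝ := (x * g₁ x - g₀ x) / x ^ 2

/-- The second derivative of `g₀ x / x`. -/
noncomputable def quot₂ (g₀ g₁ g₂ : ℝ → ℝ) (x : ℝ) : ℝ :=
  (x ^ 2 * g₂ x - 2 * x * g₁ x + 2 * g₀ x) / x ^ 3

lemma hasDerivAt_quot (h : IsError b g₀ g₁ g₂ g₃ D₂ D₃) {x : ℝ} (hx : x ∈ Ioo 0 b) :
    HasDerivAt (fun x => g₀ x / x) (quot₁ g₀ g₁ x) x := by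
  refine ((h.deriv₀ x hx).div (hasDerivAt_id x) hx.1.ne').congr_deriv ?_
  simp only [quot₁, id]
  ring

lemma hasDerivAt_quot₁ (h : IsError b g₀ g₁ g₂ g₃ D₂ D₃) {x : ℝ} (hx : x ∈ Ioo 0 b) :
    HasDerivAt (quot₁ g₀ g₁) (quot₂ g₀ g₁ g₂ x) x := by
  refine ((((hasDerivAt_id x).mul (h.deriv₁ x hx)).sub (h.deriv₀ x hx)).div (hasDerivAt_pow 2 x)
    (pow_ne_zero 2 hx.1.ne')).congr_deriv ?_
  have := hx.1.ne'
  simp only [quot₂, id, Pi.sub_apply, Pi.mul_apply]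
  field_simp
  push_cast
  ring

lemma continuousOn_quot (h : IsError b g₀ g₁ g₂ g₃ D₂ D₃) :
    ContinuousOn (fun x => g₀ x / x) (Ioc 0 b) :=
  (h.cont₀.mono Ioc_subset_Icc_self).div continuousOn_id fun _ hx => hx.1.ne'

lemma continuousOn_quot₁ (h : IsError b g₀ g₁ g₂ g₃ D₂ D₃) :
    ContinuousOn (quot₁ g₀ g₁) (Ioc 0 b) :=
  ((continuousOn_id.mul (h.cont₁.mono Ioc_subset_Icc_self)).sub
    (h.cont₀.mono Ioc_subset_Icc_self)).div (by fun_prop) fun _ hx => pow_ne_zero 2 hx.1.ne'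

lemma continuousOn_quot₂ (h : IsError b g₀ g₁ g₂ g₃ D₂ D₃) :
    ContinuousOn (quot₂ g₀ g₁ g₂) (Ioc 0 b) := by
  have h0 := h.cont₀.mono Ioc_subset_Icc_self
  have h1 := h.cont₁.mono Ioc_subset_Icc_self
  have h2 := h.cont₂.mono Ioc_subset_Icc_self
  unfold quot₂
  exact ContinuousOn.div (by fun_prop) (by fun_prop) fun _ hx => pow_ne_zero 3 hx.1.ne'

/-- The numerator `t g₁ - g₀` vanishes at `0` and has derivative `t g₂`, so the mean value theorem
bounds it by `x² D₂`. -/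
lemma abs_quot₁_le (h : IsError b g₀ g₁ g₂ g₃ D₂ D₃) {x : ℝ} (hx : x ∈ Ioc 0 b) :
    |quot₁ g₀ g₁ x| ≤ D₂ := by
  have hsub : Icc 0 x ⊆ Icc 0 b := Icc_subset_Icc_right hx.2
  have hD : 0 ≤ D₂ := (abs_nonneg _).trans (h.bound₂ 0 ⟨le_rfl, h.pos.le⟩)
  have := abs_le_mul_of_abs_deriv_le (q := fun t => t * g₁ t - g₀ t) (q' := fun t => t * g₂ t)
    (M := x * D₂) hx.1
    ((continuousOn_id.mul (h.cont₁.mono hsub)).sub (h.cont₀.mono hsub)) (fun s hs => by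
      have hs' : s ∈ Ioo 0 b := ⟨hs.1, hs.2.trans_le hx.2⟩
      refine (((hasDerivAt_id s).mul (h.deriv₁ s hs')).sub (h.deriv₀ s hs')).congr_deriv ?_
      simp) (fun s hs => by
      rw [abs_mul, abs_of_pos hs.1]
      exact mul_le_mul hs.2.le (h.bound₂ s ⟨hs.1.le, hs.2.le.trans hx.2⟩) (abs_nonneg _) hx.1.le)
    (by simp [h.zero])
  rw [quot₁, abs_div, abs_of_pos (pow_pos hx.1 2), div_le_iff₀ (pow_pos hx.1 2)]
  linarith

/-- The lower-order terms cancel in the derivative of the numerator, which is just `t² g₃`. -/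
lemma abs_quot₂_le (h : IsError b g₀ g₁ g₂ g₃ D₂ D₃) {x : ℝ} (hx : x ∈ Ioc 0 b) :
    |quot₂ g₀ g₁ g₂ x| ≤ D₃ := by
  have hsub : Icc 0 x ⊆ Icc 0 b := Icc_subset_Icc_right hx.2
  have h0 := h.cont₀.mono hsub
  have h1 := h.cont₁.mono hsub
  have h2 := h.cont₂.mono hsub
  have hD : 0 ≤ D₃ := (abs_nonneg _).trans (h.bound₃ 0 ⟨le_rfl, h.pos.le⟩)
  have := abs_le_mul_of_abs_deriv_le (q := fun t => t ^ 2 * g₂ t - 2 * t * g₁ t + 2 * g₀ t)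
    (q' := fun t => t ^ 2 * g₃ t) (M := x ^ 2 * D₃) hx.1 (by fun_prop) (fun s hs => by
      have hs' : s ∈ Ioo 0 b := ⟨hs.1, hs.2.trans_le hx.2⟩
      have e := (((hasDerivAt_pow 2 s).mul (h.deriv₂ s hs')).sub
        (((hasDerivAt_id s).const_mul 2).mul (h.deriv₁ s hs'))).add ((h.deriv₀ s hs').const_mul 2)
      refine e.congr_deriv ?_
      simp only [id]
      push_cast
      ring) (fun s hs => by
      rw [abs_mul, abs_of_pos (pow_pos hs.1 2)]
      have := hs.1
      have := hs.2
      exact mul_le_mul (by gcongr) (h.bound₃ s ⟨hs.1.le, hs.2.le.trans hx.2⟩) (abs_nonneg _)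
        (by positivity))
    (by simp [h.zero])
  rw [quot₂, abs_div, abs_of_pos (pow_pos hx.1 3), div_le_iff₀ (pow_pos hx.1 3)]
  linarith

lemma exists_abs_quot_le (h : IsError b g₀ g₁ g₂ g₃ D₂ D₃) :
    ∃ B, ∀ x ∈ Ioc 0 b, |g₀ x / x| ≤ B := by
  obtain ⟨B, hB⟩ := isCompact_Icc.exists_bound_of_continuousOn h.cont₁
  refine ⟨B, fun x hx => ?_⟩
  have := abs_le_mul_of_abs_deriv_le hx.1 (h.cont₀.mono (Icc_subset_Icc_right hx.2))
    (fun s hs => h.deriv₀ s ⟨hs.1, hs.2.trans_le hx.2⟩)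
    (fun s hs => hB s ⟨hs.1.le, hs.2.le.trans hx.2⟩) h.zero
  rwa [abs_div, abs_of_pos hx.1, div_le_iff₀ hx.1]

open MeasureTheory in
lemma intervalIntegrable_quot₁ (h : IsError b g₀ g₁ g₂ g₃ D₂ D₃) :
    IntervalIntegrable (quot₁ g₀ g₁) volume 0 b :=
  intervalIntegrable_of_norm_le (β := 0) (B := D₂) h.pos.le (by norm_num) h.continuousOn_quot₁
    fun t ht => by
      have hD : 0 ≤ D₂ := (abs_nonneg _).trans (h.abs_quot₁_le ht)
      rw [Real.rpow_zero, one_mul]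
      exact (h.abs_quot₁_le ht).trans
        (le_mul_of_one_le_right hD (by linarith [abs_nonneg (Real.log t)]))

open MeasureTheory in
lemma intervalIntegrable_quot₂ (h : IsError b g₀ g₁ g₂ g₃ D₂ D₃) :
    IntervalIntegrable (quot₂ g₀ g₁ g₂) volume 0 b :=
  intervalIntegrable_of_norm_le (β := 0) (B := D₃) h.pos.le (by norm_num) h.continuousOn_quot₂
    fun t ht => by
      have hD : 0 ≤ D₃ := (abs_nonneg _).trans (h.abs_quot₂_le ht)
      rw [Real.rpow_zero, one_mul]
      exact (h.abs_quot₂_le ht).trans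
        (le_mul_of_one_le_right hD (by linarith [abs_nonneg (Real.log t)]))

open MeasureTheory in
lemma integral_abs_le {φ : ℝ → ℝ} {b D : ℝ} (hb : 0 ≤ b)
    (hD : ∀ x ∈ Ioc 0 b, |φ x| ≤ D) : ∫ t in (0 : ℝ)..b, |φ t| ≤ b * D := by
  have h := intervalIntegral.norm_integral_le_of_norm_le (f := fun t => |φ t|) (g := fun _ => D)
    hb (μ := volume) (Filter.Eventually.of_forall fun t ht => by simpa using hD t ht) (by simp)
  simp only [intervalIntegral.integral_const, smul_eq_mul, sub_zero] at h
  exact (le_abs_self _).trans h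

open MeasureTheory in
-- No boundary term remains, because `g₀` vanishes at `b`.
lemma norm_integral_mul_quot_le (h : IsError b g₀ g₁ g₂ g₃ D₂ D₃) {k : ℝ → ℂ} {C : ℝ}
    (hk : IntervalIntegrable k volume 0 b) (hkc : ContinuousOn k (Ioo 0 b))
    (hC : ∀ y ∈ Icc 0 b, ‖∫ t in (0 : ℝ)..y, k t‖ ≤ C) :
    IntervalIntegrable (fun t => k t * ((g₀ t / t : ℝ) : ℂ)) volume 0 b ∧
    ‖∫ t in (0 : ℝ)..b, k t * ((g₀ t / t : ℝ) : ℂ)‖ ≤ C * (b * D₂) := by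
  obtain ⟨B, hB⟩ := h.exists_abs_quot_le
  have hC0 : 0 ≤ C := (norm_nonneg _).trans (hC 0 ⟨le_rfl, h.pos.le⟩)
  obtain ⟨h1, h2⟩ := norm_integral_mul_le (φ := fun t => g₀ t / t) h.pos hk hkc hC
    (fun t ht => h.hasDerivAt_quot ht) h.continuousOn_quot hB h.intervalIntegrable_quot₁
  refine ⟨h1, h2.trans ?_⟩
  have := integral_abs_le h.pos.le fun x hx => h.abs_quot₁_le hx
  simp only [h.right, zero_div, abs_zero, zero_add]
  gcongr

open MeasureTheory in
-- Here the boundary term survives: since `g₀ b = 0`, the derivative of `g₀ x / x` at `b` is `g₁ b /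
-- b`.
lemma norm_integral_mul_quot₁_le (h : IsError b g₀ g₁ g₂ g₃ D₂ D₃) {k : ℝ → ℂ} {C : ℝ}
    (hk : IntervalIntegrable k volume 0 b) (hkc : ContinuousOn k (Ioo 0 b))
    (hC : ∀ y ∈ Icc 0 b, ‖∫ t in (0 : ℝ)..y, k t‖ ≤ C) :
    IntervalIntegrable (fun t => k t * (quot₁ g₀ g₁ t : ℂ)) volume 0 b ∧
    ‖∫ t in (0 : ℝ)..b, k t * (quot₁ g₀ g₁ t : ℂ)‖ ≤ C * (1 / b * |g₁ b| + b * D₃) := by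
  have hC0 : 0 ≤ C := (norm_nonneg _).trans (hC 0 ⟨le_rfl, h.pos.le⟩)
  obtain ⟨h1, h2⟩ := norm_integral_mul_le h.pos hk hkc hC
    (fun t ht => h.hasDerivAt_quot₁ ht) h.continuousOn_quot₁ (fun t ht => h.abs_quot₁_le ht)
    h.intervalIntegrable_quot₂
  refine ⟨h1, h2.trans ?_⟩
  have := integral_abs_le h.pos.le fun x hx => h.abs_quot₂_le hx
  have e : |quot₁ g₀ g₁ b| = 1 / b * |g₁ b| := by
    have hb := h.pos
    rw [quot₁, h.right, sub_zero, abs_div, abs_mul, abs_of_pos hb, abs_of_pos (pow_pos hb 2)]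
    field_simp
  rw [e]
  gcongr

lemma integrand_eq_of_pos (α : ℝ) (m : ℂ) (ω : ℝ) (g₀ : ℝ → ℝ) {x : ℝ} (hx : 0 < x) :
    integrand α m ω g₀ x =
      ((x ^ (α + 1) * Real.log x : ℝ) : ℂ) * besselJ m (ω * x) * ((g₀ x / x : ℝ) : ℂ) := by
  have : (x : ℂ) ≠ 0 := by exact_mod_cast hx.ne'
  rw [integrand, Real.rpow_add_one hx.ne']
  push_cast
  field_simp

end IsError

lemma abs_rpow_mul_log_le (α : ℝ) {t : ℝ} (ht : 0 < t) :
    |t ^ α * Real.log t| ≤ 1 * (t ^ α * (1 + |Real.log t|)) := by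
  have := Real.rpow_pos_of_pos ht α
  rw [abs_mul, abs_of_pos this, one_mul]
  gcongr
  linarith

lemma abs_rpow_le (α : ℝ) {t : ℝ} (ht : 0 < t) :
    |t ^ α| ≤ 1 * (t ^ α * (1 + |Real.log t|)) := by
  have := Real.rpow_pos_of_pos ht α
  rw [abs_of_pos this, one_mul]
  exact le_mul_of_one_le_right this.le (by linarith [abs_nonneg (Real.log t)])

open MeasureTheory in
lemma intervalIntegrable_integrand {b α : ℝ} {m : ℂ} (hb : 0 < b) (hm : -1 < m.re)
    (hαm : -1 < α + m.re) {f : ℝ → ℝ} (hf : ContinuousOn f (Icc 0 b)) {ω : ℝ} (hω : 0 < ω) :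
    IntervalIntegrable (integrand α m ω f) volume 0 b := by
  obtain ⟨B, hB⟩ := isCompact_Icc.exists_bound_of_continuousOn hf
  refine intervalIntegrable_mul_besselJ (p := fun x => x ^ α * Real.log x * f x) (B := B) hm hω
    hb.le hαm ((((continuousOn_rpow_Ioi α).mul continuousOn_log_Ioi).mono fun _ ht => ht.1).mul
      (hf.mono Ioc_subset_Icc_self)) fun t ht => ?_
  rw [abs_mul, mul_comm]
  have h1 := abs_rpow_mul_log_le α ht.1
  rw [one_mul] at h1
  have h2 : |f t| ≤ B := hB t ⟨ht.1.le, ht.2⟩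
  exact mul_le_mul h2 h1 (abs_nonneg _) ((abs_nonneg _).trans h2)

open MeasureTheory IsError in
theorem exists_norm_integral_integrand_le {b α : ℝ} {m : ℂ} (hb : 0 < b) (hα : -1 < α)
    (hm : -1 < m.re) (hαm : -1 < α + m.re) :
    ∃ c, 0 < c ∧ ∀ (g₀ g₁ g₂ g₃ : ℝ → ℝ) (D₂ D₃ : ℝ), IsError b g₀ g₁ g₂ g₃ D₂ D₃ →
      ∀ ω, 1 ≤ ω →
        ‖∫ x in (0 : ℝ)..b, integrand α m ω g₀ x‖ ≤ c / ω * (b * D₂) ∧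
        ‖∫ x in (0 : ℝ)..b, integrand α m ω g₀ x‖ ≤
          1 / ω * (‖(α : ℂ) - m‖ * (C₂log c c α ω * (b * D₂)) + C₁ c c α ω * (b * D₂) +
            c / ω * (1 / b * |g₁ b| + b * D₃)) := by
  obtain ⟨c, hc, H⟩ := exists_kernel_bound hm hb hα
  refine ⟨c, hc, fun g₀ g₁ g₂ g₃ D₂ D₃ h ω hω => ?_⟩
  have hω0 : 0 < ω := one_pos.trans_le hω
  have hm1 : -1 < (m + 1).re := by simp; linarith
  have e : (m + 1).re = m.re + 1 := by simp
  have hlogc : ∀ β : ℝ, ContinuousOn (fun t : ℝ => t ^ β * Real.log t) (Ioi 0) := fun β =>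
    (continuousOn_rpow_Ioi β).mul continuousOn_log_Ioi
  have hJc := continuousOn_besselJ_comp_mul hm hω0
  have hJc1 := continuousOn_besselJ_comp_mul hm1 hω0
  have hlogcc : ∀ β : ℝ, ContinuousOn (fun t : ℝ => ((t ^ β * Real.log t : ℝ) : ℂ)) (Ioi 0) :=
    fun β => Complex.continuous_ofReal.comp_continuousOn (hlogc β)
  have hpowcc : ContinuousOn (fun t : ℝ => ((t ^ α : ℝ) : ℂ)) (Ioi 0) :=
    Complex.continuous_ofReal.comp_continuousOn (continuousOn_rpow_Ioi α)
  have hsub : Ioo 0 b ⊆ Ioi 0 := fun _ ht => ht.1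
  have hsub' : Ioc 0 b ⊆ Ioi 0 := fun _ ht => ht.1
  have I0 := intervalIntegrable_mul_besselJ (β := α + 1) hm hω0 hb.le (by linarith)
    ((hlogc _).mono hsub') fun t ht => abs_rpow_mul_log_le (α + 1) ht.1
  have I1 := intervalIntegrable_mul_besselJ (β := α) hm1 hω0 hb.le (by linarith)
    ((hlogc _).mono hsub') fun t ht => abs_rpow_mul_log_le α ht.1
  have I2 := intervalIntegrable_mul_besselJ (β := α) hm1 hω0 hb.le (by linarith)
    ((continuousOn_rpow_Ioi α).mono hsub') fun t ht => abs_rpow_le α ht.1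
  have I3 := intervalIntegrable_mul_besselJ (β := α + 1) hm1 hω0 hb.le (by linarith)
    ((hlogc _).mono hsub') fun t ht => abs_rpow_mul_log_le (α + 1) ht.1
  obtain ⟨-, T0⟩ := h.norm_integral_mul_quot_le I0 (((hlogcc _).mul hJc).mono hsub)
    fun y hy => (H ω hω y hy).2.2.1
  obtain ⟨i1, T1⟩ := h.norm_integral_mul_quot_le I1 (((hlogcc _).mul hJc1).mono hsub)
    fun y hy => (H ω hω y hy).2.1
  obtain ⟨i2, T2⟩ := h.norm_integral_mul_quot_le I2 ((hpowcc.mul hJc1).mono hsub)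
    fun y hy => (H ω hω y hy).1
  obtain ⟨i3, T3⟩ := h.norm_integral_mul_quot₁_le I3 (((hlogcc _).mul hJc1).mono hsub)
    fun y hy => (H ω hω y hy).2.2.2
  constructor
  · rw [intervalIntegral.integral_congr_ae (g := fun x => ((x ^ (α + 1) * Real.log x : ℝ) : ℂ) *
      besselJ m (ω * x) * ((g₀ x / x : ℝ) : ℂ)) (Filter.Eventually.of_forall fun x hx => by
        rw [uIoc_of_le hb.le] at hx
        exact integrand_eq_of_pos α m ω g₀ hx.1)]
    exact T0
  have hI := intervalIntegrable_integrand hb hm hαm h.cont₀ hω0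
  -- Substituting `g₀' = x (g₀ / x)' + g₀ / x` changes the coefficient `α - (m + 1)` into `α - m`
  -- and leaves only `g₀ / x` and its derivative. Both boundary values are `0`.
  have hFTC := intervalIntegral.integral_eq_sub_of_hasDerivAt_of_tendsto hb
    (f := fun x => ((x ^ α * Real.log x * g₀ x : ℝ) : ℂ) * besselJ (m + 1) (ω * x))
    (f' := fun x => ω * integrand α m ω g₀ x +
      (((α : ℂ) - m) * (((x ^ α * Real.log x : ℝ) : ℂ) * besselJ (m + 1) (ω * x) *
          ((g₀ x / x : ℝ) : ℂ)) +
        ((x ^ α : ℝ) : ℂ) * besselJ (m + 1) (ω * x) * ((g₀ x / x : ℝ) : ℂ) +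
        ((x ^ (α + 1) * Real.log x : ℝ) : ℂ) * besselJ (m + 1) (ω * x) *
          (quot₁ g₀ g₁ x : ℂ))) (fa := 0) (fb := 0) (fun x hx => by
      have h1 := (((hasDerivAt_rpow_mul_log (α := α) hx.1).mul (h.deriv₀ x hx)).ofReal_comp).mul
        (hasDerivAt_besselJ_comp_mul hm hω0 hx.1)
      refine h1.congr_deriv ?_
      have hxc : (x : ℂ) ≠ 0 := by exact_mod_cast hx.1.ne'
      rw [integrand, Real.rpow_add_one hx.1.ne', Real.rpow_sub_one hx.1.ne', quot₁]
      simp only [Pi.mul_apply]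
      push_cast
      field_simp
      ring)
    ((hI.const_mul _).add (((i1.const_mul _).add i2).add i3)) (by
      obtain ⟨B, hB⟩ := h.exists_abs_quot_le
      obtain ⟨J, hJ0, hJ⟩ := exists_norm_besselJ_mul_le_rpow_re hm1 hω0 b
      -- With this exponent the powers from the weight, the logarithm and `J_{m+1}` cancel exactly,
      -- and the factor `x` from `g₀` is left.
      obtain ⟨D, hD0, hD⟩ := exists_abs_log_le_rpow (ε := α + m.re + 1) (by linarith) b
      refine squeeze_zero_norm' (a := fun x => D * B * J * x) ?_ ?_
      · filter_upwards [Ioc_mem_nhdsGT hb] with x hx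
        have hxp := Real.rpow_pos_of_pos hx.1 α
        have hg : |g₀ x| ≤ B * x := by
          have := hB x hx
          rwa [abs_div, abs_of_pos hx.1, div_le_iff₀ hx.1] at this
        rw [norm_mul, Complex.norm_real, Real.norm_eq_abs, abs_mul, abs_mul, abs_of_pos hxp]
        have hBx : 0 ≤ B * x := (abs_nonneg _).trans hg
        have hDx : 0 ≤ D * x ^ (-(α + m.re + 1)) := (abs_nonneg _).trans (hD x hx)
        calc _ ≤ x ^ α * (D * x ^ (-(α + m.re + 1))) * (B * x) * (J * x ^ (m + 1).re) := by
              gcongr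
              · exact hD x hx
              · exact hJ x hx
          _ = D * B * J * x * (x ^ α * x ^ (-(α + m.re + 1)) * x ^ (m + 1).re) := by ring
          _ = _ := by
            rw [← Real.rpow_add hx.1, ← Real.rpow_add hx.1, e]
            have : α + -(α + m.re + 1) + (m.re + 1) = 0 := by ring
            rw [this, Real.rpow_zero, mul_one]
      · have : Filter.Tendsto (fun x : ℝ => D * B * J * x) (nhds 0) (nhds (D * B * J * 0)) :=
          (continuous_const.mul continuous_id).tendsto 0
        rw [mul_zero] at this
        exact this.mono_left nhdsWithin_le_nhds) (by
      have hcont : ContinuousOn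
          (fun x => ((x ^ α * Real.log x * g₀ x : ℝ) : ℂ) * besselJ (m + 1) (ω * x)) (Ioc 0 b) :=
        (Complex.continuous_ofReal.comp_continuousOn (((hlogc α).mono hsub').mul
          (h.cont₀.mono Ioc_subset_Icc_self))).mul (hJc1.mono hsub')
      have h1 := (hcont b ⟨hb, le_rfl⟩).mono (s := Ioo 0 b) Ioo_subset_Ioc_self
      rw [ContinuousWithinAt, nhdsWithin_Ioo_eq_nhdsLT hb] at h1
      simpa [h.right] using h1)
  rw [intervalIntegral.integral_add (hI.const_mul _) (((i1.const_mul _).add i2).add i3),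
    intervalIntegral.integral_add ((i1.const_mul _).add i2) i3,
    intervalIntegral.integral_add (i1.const_mul _) i2, intervalIntegral.integral_const_mul,
    intervalIntegral.integral_const_mul, sub_zero] at hFTC
  have hn := congrArg norm (eq_neg_of_add_eq_zero_left hFTC)
  rw [norm_mul, norm_neg, Complex.norm_real, Real.norm_eq_abs, abs_of_pos hω0] at hn
  rw [one_div, inv_mul_eq_div, le_div_iff₀ hω0, mul_comm, hn]
  refine (norm_add_le _ _).trans (add_le_add ((norm_add_le _ _).trans (add_le_add ?_ T2)) T3)
  rw [norm_mul]
  gcongr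

/-! ### The first bound -/

open MeasureTheory in
lemma integral_abs_rpow_mul_log {b α : ℝ} (hb : 0 < b) (hα : -1 < α) :
    ∫ x in (0 : ℝ)..b, |x ^ α * Real.log x| =
      if b ≤ 1 then b ^ (α + 1) * (1 - (α + 1) * Real.log b) / (α + 1) ^ 2
      else (2 + b ^ (α + 1) * ((α + 1) * Real.log b - 1)) / (α + 1) ^ 2 := by
  have hα1 : 0 < α + 1 := by linarith
  set P : ℝ → ℝ := fun x => x ^ (α + 1) * ((α + 1) * Real.log x - 1) / (α + 1) ^ 2 with hP
  have hd : ∀ x, 0 < x → HasDerivAt P (x ^ α * Real.log x) x := by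
    intro x hx
    have h1 := (((hasDerivAt_rpow_mul_log (α := α + 1) hx).const_mul (α + 1)).sub
      (Real.hasDerivAt_rpow_const (p := α + 1) (Or.inl hx.ne'))).div_const ((α + 1) ^ 2)
    have e : P = fun x => ((α + 1) * (x ^ (α + 1) * Real.log x) - x ^ (α + 1)) / (α + 1) ^ 2 := by
      funext x; simp only [hP]; ring
    rw [e]
    refine h1.congr_deriv ?_
    rw [add_sub_cancel_right]
    field_simp
    ring
  have hint : ∀ R, 0 ≤ R → IntervalIntegrable (fun x : ℝ => x ^ α * Real.log x) volume 0 R :=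
    fun R hR => intervalIntegrable_of_norm_le hR hα
      (((continuousOn_rpow_Ioi α).mul continuousOn_log_Ioi).mono fun _ ht => ht.1)
      fun t ht => abs_rpow_mul_log_le α ht.1
  have hlim : Filter.Tendsto P (nhdsWithin 0 (Ioi 0)) (nhds 0) := by
    have h1 := tendsto_log_mul_rpow_nhdsGT_zero hα1
    have h2 : Filter.Tendsto (fun x : ℝ => x ^ (α + 1)) (nhdsWithin 0 (Ioi 0)) (nhds 0) := by
      have := (Real.continuousAt_rpow_const 0 (α + 1) (Or.inr hα1.le)).tendsto
      rw [Real.zero_rpow hα1.ne'] at this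
      exact this.mono_left nhdsWithin_le_nhds
    have h3 := ((h1.const_mul (α + 1)).sub h2).div_const ((α + 1) ^ 2)
    simp only [mul_zero, sub_zero, zero_div] at h3
    refine h3.congr fun x => ?_
    simp only [hP]; ring
  have h0 : ∀ R, 0 < R → ∫ x in (0 : ℝ)..R, x ^ α * Real.log x = P R := by
    intro R hR
    rw [intervalIntegral.integral_eq_sub_of_hasDerivAt_of_tendsto hR (fun x hx => hd x hx.1)
      (hint R hR.le) hlim ((hd R hR).continuousAt.tendsto.mono_left nhdsWithin_le_nhds), sub_zero]
  have hsmall : ∀ R, 0 < R → R ≤ 1 → ∫ x in (0 : ℝ)..R, |x ^ α * Real.log x| = -P R := by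
    intro R hR hR1
    rw [← h0 R hR, ← intervalIntegral.integral_neg]
    refine intervalIntegral.integral_congr_ae (Filter.Eventually.of_forall fun x hx => ?_)
    rw [uIoc_of_le hR.le] at hx
    exact abs_of_nonpos (mul_nonpos_of_nonneg_of_nonpos (Real.rpow_nonneg hx.1.le _)
      (Real.log_nonpos hx.1.le (hx.2.trans hR1)))
  split_ifs with hb1
  · rw [hsmall b hb hb1]; simp only [hP]; ring
  · have hb1' : 1 ≤ b := (not_le.1 hb1).le
    have i1 := (hint 1 zero_le_one).abs
    have ib := (hint b hb.le)
    have i1b : IntervalIntegrable (fun x : ℝ => x ^ α * Real.log x) volume 1 b :=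
      ib.mono_set (by
        rw [uIcc_of_le hb1', uIcc_of_le hb.le]; exact Icc_subset_Icc_left zero_le_one)
    have e1 : ∫ x in (1 : ℝ)..b, |x ^ α * Real.log x| = ∫ x in (1 : ℝ)..b, x ^ α * Real.log x := by
      refine intervalIntegral.integral_congr_ae (Filter.Eventually.of_forall fun x hx => ?_)
      rw [uIoc_of_le hb1'] at hx
      exact abs_of_nonneg (mul_nonneg (Real.rpow_nonneg (by linarith [hx.1]) _)
        (Real.log_nonneg hx.1.le))
    have e2 := intervalIntegral.integral_add_adjacent_intervals (hint 1 zero_le_one) i1b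
    rw [h0 1 one_pos, h0 b hb] at e2
    rw [← intervalIntegral.integral_add_adjacent_intervals i1 i1b.abs, e1,
      hsmall 1 one_pos le_rfl]
    -- The total is `P b - 2 P 1`, and `P 1 = -1 / (α + 1) ^ 2` produces the `2` in the numerator.
    have e3 : ∫ x in (1 : ℝ)..b, x ^ α * Real.log x = P b - P 1 := by linarith
    rw [e3]
    simp only [hP, Real.one_rpow, Real.log_one]
    ring

open MeasureTheory in
lemma norm_integral_integrand_le_of_nonneg {b α : ℝ} {m : ℂ} (hb : 0 < b) (hα : -1 < α)
    (him : m.im = 0) (hre : 0 ≤ m.re) {g : ℝ → ℝ} {D : ℝ} (hD : ∀ x ∈ Icc 0 b, |g x| ≤ D)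
    {ω : ℝ} (hω : 0 < ω) :
    ‖∫ x in (0 : ℝ)..b, integrand α m ω g x‖ ≤ (∫ x in (0 : ℝ)..b, |x ^ α * Real.log x|) * D := by
  have hint : IntervalIntegrable (fun x : ℝ => x ^ α * Real.log x) volume 0 b :=
    intervalIntegrable_of_norm_le hb.le hα
      (((continuousOn_rpow_Ioi α).mul continuousOn_log_Ioi).mono fun _ ht => ht.1)
      fun t ht => abs_rpow_mul_log_le α ht.1
  rw [← intervalIntegral.integral_mul_const]
  refine intervalIntegral.norm_integral_le_of_norm_le hb.le
    (Filter.Eventually.of_forall fun x hx => ?_) (hint.abs.mul_const D)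
  have hmr : m = (m.re : ℂ) := Complex.ext rfl (by simp [him])
  have hJ : ‖besselJ m (ω * x)‖ ≤ 1 := by
    rw [hmr, norm_besselJ_ofReal _ (mul_pos hω hx.1)]
    exact abs_besselR_le_one hre (mul_pos hω hx.1)
  have hgx := hD x ⟨hx.1.le, hx.2⟩
  rw [integrand, norm_mul, Complex.norm_real, Real.norm_eq_abs, abs_mul]
  calc _ ≤ |x ^ α * Real.log x| * D * 1 := by
        gcongr
        exact mul_nonneg (abs_nonneg _) ((abs_nonneg _).trans hgx)
    _ = _ := mul_one _

/-! ### The interpolation error -/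

lemma injOn_node {b : ℝ} (hb : 0 < b) {N : ℕ} (hN : 1 ≤ N) :
    InjOn (node b N) (Finset.range (N + 1)) := by
  intro i hi j hj hij
  have hN0 : (0 : ℝ) < N := by exact_mod_cast hN
  have hmem : ∀ k ∈ Finset.range (N + 1), (k * Real.pi / N : ℝ) ∈ Icc 0 Real.pi := by
    intro k hk
    have hk' : (k : ℝ) ≤ N := by exact_mod_cast Nat.lt_succ_iff.1 (Finset.mem_range.1 hk)
    refine ⟨by positivity, ?_⟩
    rw [div_le_iff₀ hN0, mul_comm]
    have := Real.pi_pos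
    gcongr
  have hcos : Real.cos (i * Real.pi / N) = Real.cos (j * Real.pi / N) := by
    have hb2 : b / 2 ≠ 0 := by positivity
    exact mul_left_cancel₀ hb2 (add_left_cancel hij)
  have h := Real.injOn_cos (hmem i hi) (hmem j hj) hcos
  have hpi := Real.pi_ne_zero
  field_simp at h
  exact_mod_cast h

lemma eval_interp_node {b : ℝ} (hb : 0 < b) {N : ℕ} (hN : 1 ≤ N) (f : ℝ → ℝ) {k : ℕ}
    (hk : k ≤ N) : (interp b N f).eval (node b N k) = f (node b N k) :=
  Lagrange.eval_interpolate_at_node (fun k => f (node b N k)) (injOn_node hb hN)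
    (Finset.mem_range.2 (Nat.lt_succ_of_le hk))

lemma continuousOn_derivErr {b : ℝ} (hb : 0 < b) (N : ℕ) {k : ℕ} {f : ℝ → ℝ}
    (hf : ContDiffOn ℝ 3 f (Icc 0 b)) (hk : k ≤ 3) :
    ContinuousOn (derivErr b N k f) (Icc 0 b) :=
  (hf.continuousOn_iteratedDerivWithin (by exact_mod_cast hk) (uniqueDiffOn_Icc hb)).sub
    (Polynomial.continuousOn _)

lemma hasDerivAt_derivErr {b : ℝ} (hb : 0 < b) (N : ℕ) {k : ℕ} {f : ℝ → ℝ}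
    (hf : ContDiffOn ℝ 3 f (Icc 0 b)) (hk : k < 3) {x : ℝ} (hx : x ∈ Ioo 0 b) :
    HasDerivAt (derivErr b N k f) (derivErr b N (k + 1) f x) x := by
  have hd := hf.differentiableOn_iteratedDerivWithin (m := k) (by exact_mod_cast hk)
    (uniqueDiffOn_Icc hb) x (Ioo_subset_Icc_self hx)
  have h1 := hd.hasDerivWithinAt.hasDerivAt (Icc_mem_nhds hx.1 hx.2)
  rw [← iteratedDerivWithin_succ] at h1
  have h2 := (derivative^[k] (interp b N f)).hasDerivAt x
  rw [← Function.iterate_succ_apply' derivative k] at h2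
  exact h1.sub h2

/-- Continuity on the compact interval makes the supremum finite; an unbounded family would have the
default supremum `0`. -/
lemma abs_le_supNorm {b : ℝ} {g : ℝ → ℝ} (hg : ContinuousOn g (Icc 0 b)) {x : ℝ}
    (hx : x ∈ Icc 0 b) : |g x| ≤ supNorm b g := by
  obtain ⟨B, hB⟩ := isCompact_Icc.exists_bound_of_continuousOn hg
  refine le_ciSup (f := fun x : Icc (0 : ℝ) b => |g x|) ⟨B, ?_⟩ ⟨x, hx⟩
  rintro _ ⟨y, rfl⟩
  exact hB y y.2

/-- The zeros at the ends come from the nodes `k = N`, which is `0`, and `k = 0`, which is `b`. -/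
lemma isError_derivErr {b : ℝ} (hb : 0 < b) {N : ℕ} (hN : 1 ≤ N) {f : ℝ → ℝ}
    (hf : ContDiffOn ℝ 3 f (Icc 0 b)) :
    IsError b (derivErr b N 0 f) (derivErr b N 1 f) (derivErr b N 2 f) (derivErr b N 3 f)
      (supNorm b (derivErr b N 2 f)) (supNorm b (derivErr b N 3 f)) where
  pos := hb
  zero := by
    have h := eval_interp_node hb hN f le_rfl
    have hN0 : (N : ℝ) ≠ 0 := by exact_mod_cast Nat.one_le_iff_ne_zero.1 hN
    have e : node b N N = 0 := by
      rw [node, mul_div_right_comm, div_self hN0, one_mul, Real.cos_pi]; ring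
    rw [e] at h
    simp [derivErr, h]
  right := by
    have h := eval_interp_node hb hN f (Nat.zero_le N)
    have e : node b N 0 = b := by simp [node]
    rw [e] at h
    simp [derivErr, h]
  cont₀ := continuousOn_derivErr hb N hf (by norm_num)
  cont₁ := continuousOn_derivErr hb N hf (by norm_num)
  cont₂ := continuousOn_derivErr hb N hf (by norm_num)
  cont₃ := continuousOn_derivErr hb N hf (by norm_num)
  deriv₀ := fun _ hx => hasDerivAt_derivErr hb N hf (by norm_num) hx
  deriv₁ := fun _ hx => hasDerivAt_derivErr hb N hf (by norm_num) hx
  deriv₂ := fun _ hx => hasDerivAt_derivErr hb N hf (by norm_num) hx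
  bound₂ := fun _ hx => abs_le_supNorm (continuousOn_derivErr hb N hf (by norm_num)) hx
  bound₃ := fun _ hx => abs_le_supNorm (continuousOn_derivErr hb N hf (by norm_num)) hx

end CCF

/-! ### Assembly of the three bounds -/

theorem theorem3p2 (b α : ℝ) (m : ℂ) (hb : 0 < b) (hα : -1 < α) (hm : -1 < m.re)
    (hαm : -1 < α + m.re) :
    ∃ c₁ c₂ c₃ c₄ : ℝ, 0 < c₁ ∧ 0 < c₂ ∧ 0 < c₃ ∧ 0 < c₄ ∧
      ∀ (f : ℝ → ℝ), ContDiffOn ℝ 3 f (Set.Icc 0 b) →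
      ∀ (N : ℕ), 1 ≤ N → ∀ (ω : ℝ), 1 ≤ ω →
        IntervalIntegrable (CCF.integrand α m ω f) MeasureTheory.volume 0 b ∧
        IntervalIntegrable (CCF.integrand α m ω (fun x => (CCF.interp b N f).eval x))
          MeasureTheory.volume 0 b ∧
        ‖CCF.transform b α m ω f - CCF.rule b α m ω N f‖ ≤
          min (CCF.bound₂ c₃ c₄ b α ω N f) (CCF.bound₃ c₁ c₂ c₃ c₄ b α m ω N f) ∧
        (m.im = 0 → 0 ≤ m.re →
          ‖CCF.transform b α m ω f - CCF.rule b α m ω N f‖ ≤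
            min (CCF.bound₁ b α N f)
              (min (CCF.bound₂ c₃ c₄ b α ω N f) (CCF.bound₃ c₁ c₂ c₃ c₄ b α m ω N f))) := by
  obtain ⟨c, hc, H⟩ := CCF.exists_norm_integral_integrand_le hb hα hm hαm
  refine ⟨c, c, c, c, hc, hc, hc, hc, fun f hf N hN ω hω => ?_⟩
  have hω0 : 0 < ω := one_pos.trans_le hω
  have herr := CCF.isError_derivErr hb hN hf
  have hint1 := CCF.intervalIntegrable_integrand hb hm hαm hf.continuousOn hω0
  have hint2 := CCF.intervalIntegrable_integrand hb hm hαm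
    (Polynomial.continuousOn (CCF.interp b N f) (s := Icc 0 b)) hω0
  have hdiff : CCF.transform b α m ω f - CCF.rule b α m ω N f =
      ∫ x in (0 : ℝ)..b, CCF.integrand α m ω (CCF.derivErr b N 0 f) x := by
    rw [CCF.transform, CCF.rule, CCF.transform, ← intervalIntegral.integral_sub hint1 hint2]
    refine intervalIntegral.integral_congr fun x _ => ?_
    simp only [CCF.integrand, CCF.derivErr, iteratedDerivWithin_zero, Function.iterate_zero, id]
    push_cast
    ring
  obtain ⟨h2, h3⟩ := H _ _ _ _ _ _ herr ω hω
  rw [← hdiff] at h2 h3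
  have hD2 : 0 ≤ CCF.supNorm b (CCF.derivErr b N 2 f) :=
    (abs_nonneg _).trans (herr.bound₂ 0 ⟨le_rfl, hb.le⟩)
  have hD3 : 0 ≤ CCF.supNorm b (CCF.derivErr b N 3 f) :=
    (abs_nonneg _).trans (herr.bound₃ 0 ⟨le_rfl, hb.le⟩)
  have hC2 := CCF.div_le_C₂ hc.le α hω
  have hC2nonneg : 0 ≤ CCF.C₂ c c α ω := (by positivity : 0 ≤ c / ω).trans hC2
  have hl := Real.log_nonneg hω
  have hC1nonneg : 0 ≤ CCF.C₁ c c α ω := by rw [CCF.C₁]; split_ifs <;> positivity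
  have hC2log : 0 ≤ CCF.C₂log c c α ω := by rw [CCF.C₂log]; split_ifs <;> positivity
  have B2 : ‖CCF.transform b α m ω f - CCF.rule b α m ω N f‖ ≤ CCF.bound₂ c c b α ω N f := by
    refine h2.trans ?_
    rw [CCF.bound₂]
    calc _ ≤ CCF.C₂ c c α ω * (b * CCF.supNorm b (CCF.derivErr b N 2 f)) := by gcongr
      _ = _ := by ring
  have B3 : ‖CCF.transform b α m ω f - CCF.rule b α m ω N f‖ ≤
      CCF.bound₃ c c c c b α m ω N f := by
    refine h3.trans ?_
    rw [CCF.bound₃]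
    set D₂ := CCF.supNorm b (CCF.derivErr b N 2 f)
    set D₃ := CCF.supNorm b (CCF.derivErr b N 3 f)
    set K := CCF.C₁ c c α ω + ‖(α : ℂ) - m‖ * CCF.C₂log c c α ω with hK
    have hK0 : 0 ≤ K := by positivity
    -- The argument yields the factors `2` and `1` where the claim has `3` and `7 / 3`, and `c / ω`
    -- where it has `C₂`; the rest is monotonicity.
    have e1 : 1 / ω * (‖(α : ℂ) - m‖ * (CCF.C₂log c c α ω * (b * D₂)) +
        CCF.C₁ c c α ω * (b * D₂) + c / ω * (1 / b * |CCF.derivErr b N 1 f b| + b * D₃)) =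
        2 * b / (2 * ω) * K * D₂ +
          c / ω / ω * (1 / b * |CCF.derivErr b N 1 f b| + 1 * b * D₃) := by
      rw [hK]; field_simp; ring
    rw [e1]
    gcongr
    · norm_num
    · norm_num
  refine ⟨hint1, hint2, le_min B2 B3, fun him hre => le_min ?_ (le_min B2 B3)⟩
  rw [hdiff]
  refine (CCF.norm_integral_integrand_le_of_nonneg hb hα him hre
    (fun x hx => CCF.abs_le_supNorm herr.cont₀ hx) hω0).trans_eq ?_
  rw [CCF.integral_abs_rpow_mul_log hb hα, CCF.bound₁]
  split_ifs <;> rfl
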